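/- Let $\beta=(\beta_1,\beta_2,\beta_3)$ be a composition of length $3$ with every part at least $2$, and let $R_\beta$ be the connected ribbon with row lengths $\beta_1,\beta_2,\beta_3$ from top to bottom, i.e. the skew shape with these row lengths in which any two consecutive rows have exactly one column in common. For a skew shape $A$, let $r(A)$ and $c(A)$ be the partitions formed by its row lengths and by its column lengths, let $c(A)'$ be the conjugate of $c(A)$, and write $s_A=\sum_\nu c_A^\nu s_\nu$ for the expansion of the skew Schur function $s_A$ in Schur functions. The support of $A$ is the set of partitions $\{\nu : c_A^\nu>0\}$, the Schur interval of $A$ is the interval $[r(A),c(A)']$ in the dominance order on the partitions of $|A|$, and $A$ has full support if its support is equal to its Schur interval. (1) $R_\beta$ has full support if and only if neither $\beta_1\ge\beta_2+\beta_3$ nor $\beta_3\ge\beta_1+\beta_2$ holds; that is, $R_\beta$ has full support except when the largest part comes first or last and is at least the sum of the other two parts. (2) If $\beta_1\ge\beta_2+\beta_3$, then the partition $\nu=(\beta_1,\beta_2+\beta_3)$ lies in the Schur interval but not in the support of $R_\beta$. If $\beta_3\ge\beta_1+\beta_2$, then the partition $\nu=(\beta_3,\beta_1+\beta_2)$ lies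 in the Schur interval but not in the support of $R_\beta$. (3) In particular, if $\beta_2\ge\beta_1+\beta_3$, then $R_\beta$ has full support, whereas the connected ribbon $R_{\beta^+}$ of the weakly decreasing rearrangement $\beta^+$ of $\beta$ does not. Hence there is a non-monotone composition $\beta$ of length $3$ with parts at least $2$ such that $R_\beta$ has full support while $R_{\beta^+}$ does not. -/

import Mathlib

/-- The partition (as a Young diagram) whose parts are the nonzero members of the multiset `s`,
arranged in weakly decreasing order. -/
def partitionOfParts (s : Multiset ℕ) : YoungDiagram :=
  YoungDiagram.ofRowLens (s.sort (· ≥ ·)) (s.pairwise_sort (· ≥ ·)).sortedGE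

/-- Dominance order `μ ⪯ ν` on partitions of the same size: every partial sum of the parts of `μ`
is at most the corresponding partial sum of the parts of `ν`. -/
def DominanceLE (μ ν : YoungDiagram) : Prop :=
  μ.card = ν.card ∧
    ∀ k : ℕ, ∑ i ∈ Finset.range k, μ.rowLen i ≤ ∑ i ∈ Finset.range k, ν.rowLen i

/-- A skew shape `outer / inner`. Cells are pairs (row, column); rows are numbered downwards. -/
structure SkewShape where
  outer : YoungDiagram
  inner : YoungDiagram
  inner_le_outer : inner ≤ outer

namespace SkewShape

/-- The boxes of a skew shape. -/
def cells (A : SkewShape) : Finset (ℕ × ℕ) := A.outer.cells \ A.inner.cells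

/-- The straight shape `ν / ∅`. -/
def straight (ν : YoungDiagram) : SkewShape := ⟨ν, ⊥, bot_le⟩

/-- The partition `r(A)` formed by the row lengths of `A`. -/
def rowPartition (A : SkewShape) : YoungDiagram :=
  partitionOfParts ((A.cells.image Prod.fst).val.map fun i => (A.cells.filter (·.1 = i)).card)

/-- The partition `c(A)` formed by the column lengths of `A`. -/
def colPartition (A : SkewShape) : YoungDiagram :=
  partitionOfParts ((A.cells.image Prod.snd).val.map fun j => (A.cells.filter (·.2 = j)).card)

/-- The Schur interval `[r(A), c(A)']` in the dominance order. -/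
def schurInterval (A : SkewShape) : Set YoungDiagram :=
  {ν | DominanceLE A.rowPartition ν ∧ DominanceLE ν A.colPartition.transpose}

/-- Semistandard tableaux of skew shape `A`: fillings of the boxes, weakly increasing along rows
and strictly increasing down columns. As in `SemistandardYoungTableau`, the alphabet is `ℕ`
(letters start at `0`). -/
structure SSYT (A : SkewShape) where
  entry : A.cells → ℕ
  row_weak : ∀ c d : A.cells, c.1.1 = d.1.1 → c.1.2 ≤ d.1.2 → entry c ≤ entry d
  col_strict : ∀ c d : A.cells, c.1.2 = d.1.2 → c.1.1 < d.1.1 → entry c < entry d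

/-- The content of a tableau: the letter `i` is sent to its number of occurrences. -/
noncomputable def SSYT.content {A : SkewShape} (T : A.SSYT) : ℕ →₀ ℕ :=
  ∑ c : A.cells, Finsupp.single (T.entry c) 1

/-- Only finitely many tableaux of a given shape have a given content, so that `Nat.card` in
`skewSchur` is an honest count. -/
theorem finite_ssyt_content (A : SkewShape) (w : ℕ →₀ ℕ) :
    Finite {T : A.SSYT // T.content = w} := by
  have key : ∀ (T : A.SSYT) (c : A.cells), T.content = w → T.entry c ∈ w.support := by
    rintro T c rfl
    rw [Finsupp.mem_support_iff, SSYT.content, Finsupp.finsetSum_apply]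
    refine (Finset.sum_pos' (fun _ _ => Nat.zero_le _) ⟨c, Finset.mem_univ c, ?_⟩).ne'
    simp
  refine Finite.of_injective
    (fun (T : {T : A.SSYT // T.content = w}) (c : A.cells) =>
      (⟨T.1.entry c, key T.1 c T.2⟩ : w.support)) ?_
  rintro ⟨⟨e, _, _⟩, _⟩ ⟨⟨e', _, _⟩, _⟩ h
  have : e = e' := funext fun c => congrArg Subtype.val (congrFun h c)
  subst this
  rfl

/-- The skew Schur function `s_A = ∑_T x^T`, the sum being over all semistandard tableaux of
shape `A`, as a power series in the variables `x_0, x_1, …`. -/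
noncomputable def skewSchur (A : SkewShape) : MvPowerSeries ℕ ℚ :=
  fun w => (Nat.card {T : A.SSYT // T.content = w} : ℚ)

/-- The Schur function `s_ν`. -/
noncomputable def schur (ν : YoungDiagram) : MvPowerSeries ℕ ℚ := skewSchur (straight ν)

/-- The Schur support of `A`: the partitions `ν` such that `s_ν` occurs with positive
coefficient in the expansion `s_A = ∑_ν c_ν s_ν` into Schur functions (there is exactly one such
expansion, the Schur functions being a basis of the ring of symmetric functions). -/
def schurSupport (A : SkewShape) : Set YoungDiagram :=
  {ν | ∃ c : YoungDiagram →₀ ℚ, skewSchur A = c.sum (fun μ a => a • schur μ) ∧ 0 < c ν}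

/-- `A` has full Schur support. -/
def HasFullSupport (A : SkewShape) : Prop := A.schurSupport = A.schurInterval

/-- The connected ribbon `R_β` with row lengths `β₁, β₂, …` (all positive) from top to bottom,
two consecutive rows having exactly one column in common. The row `i` (counted from `0`) occupies
the columns from `∑_{k > i} (β_k - 1)` to `∑_{k ≥ i} (β_k - 1)`, both included. -/
def ribbon (β : List ℕ) : SkewShape where
  outer := YoungDiagram.ofRowLens
    ((List.range β.length).map fun i => ((β.drop i).map (· - 1)).sum + 1) (by
      refine List.Pairwise.sortedGE (List.pairwise_map.2 ?_)
      refine List.pairwise_lt_range.imp fun {i j} hij => ?_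
      exact Nat.succ_le_succ
        (((List.drop_sublist_drop_left β hij.le).map (· - 1)).sum_le_sum fun _ _ => Nat.zero_le _))
  inner := YoungDiagram.ofRowLens
    ((List.range β.length).map fun i => ((β.drop (i + 1)).map (· - 1)).sum) (by
      refine List.Pairwise.sortedGE (List.pairwise_map.2 ?_)
      refine List.pairwise_lt_range.imp fun {i j} hij => ?_
      exact ((List.drop_sublist_drop_left β (Nat.succ_le_succ hij.le)).map
        (· - 1)).sum_le_sum fun _ _ => Nat.zero_le _)
  inner_le_outer := by
    intro c hc
    have hc' := YoungDiagram.mem_ofRowLens.1 hc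
    refine YoungDiagram.mem_ofRowLens.2 ?_
    obtain ⟨h, hlt⟩ := hc'
    refine ⟨by simpa using h, ?_⟩
    simp only [List.getElem_map, List.getElem_range] at hlt ⊢
    have := ((List.drop_sublist_drop_left β (Nat.le_succ c.1)).map (· - 1)).sum_le_sum
      (fun _ _ => Nat.zero_le _)
    exact Nat.lt_succ_of_lt (hlt.trans_le this)

end SkewShape

/-! Write $h_m = s_{(m)}$, $(a,b,c)=\beta$ and $n=a+b+c$. Cutting a filling into rows gives
$s_{R_{ab}} = h_ah_b - h_{a+b}$ for two rows and $s_{R_{abc}} = s_{R_{ab}}h_c - s_{R_{a,b+c}}$ for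
three: a pair of increasing words either meets the column condition or concatenates to a longer
increasing word (`skewSchur_ribbon`).

Pieri's rule turns this into Schur functions (`schur_pieri`). The coefficient of $s_{(x,y,z)}$,
where $x+y+z=n$, is the number of $k$ with $\max(1,z,y+z-c)\le k\le\min(a,b,y,a+b-y)$, minus 1 if
$z=0$ and $1\le y\le\min(a,b+c)$ (`ribbonCoeff_threeRow`). By linear independence of the Schur
functions (`linearIndependent_schur`) these coefficients determine the support.

The Schur interval consists of the $(x,y,z)$ with $x\ge\max(a,b,c)$, $z\le\min(a,b,c)$ and $x\le
n-2$. Comparing the two ends of the range of $k$ shows that the support lies inside it, and that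
only $z=0$ can cause a gap. If $a\ge b+c$, then at $(a,b+c)$ only $k=b$ remains and is cancelled; if
$c\ge a+b$, then at $(c,a+b)$ the range is empty. In every other case the count exceeds the
subtracted term throughout the interval. -/

namespace YoungDiagram

/-! ### Partial row sums and weights of Young diagrams. -/

theorem card_filter_row_lt (μ : YoungDiagram) (k : ℕ) :
    (μ.cells.filter (·.1 < k)).card = ∑ i ∈ Finset.range k, μ.rowLen i := by
  rw [Finset.card_eq_sum_card_fiberwise (f := Prod.fst) (t := Finset.range k)
    (fun c hc => by simpa using (Finset.mem_filter.1 hc).2)]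
  refine Finset.sum_congr rfl fun i hi => ?_
  rw [rowLen_eq_card, row, Finset.filter_filter]
  congr 1
  ext c
  simp only [Finset.mem_filter, and_congr_right_iff]
  rintro -
  have := Finset.mem_range.1 hi
  constructor
  · exact fun h => h.2
  · exact fun h => ⟨by omega, h⟩

theorem ext_rowLen {μ ν : YoungDiagram} (h : ∀ i, μ.rowLen i = ν.rowLen i) : μ = ν := by
  ext ⟨i, j⟩
  rw [mem_cells, mem_cells, mem_iff_lt_rowLen, mem_iff_lt_rowLen, h]

theorem eq_of_sum_rowLen_eq {μ ν : YoungDiagram}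
    (h : ∀ k, ∑ i ∈ Finset.range k, μ.rowLen i = ∑ i ∈ Finset.range k, ν.rowLen i) : μ = ν := by
  refine ext_rowLen fun i => ?_
  have h1 := h (i + 1)
  rw [Finset.sum_range_succ, Finset.sum_range_succ, h i] at h1
  omega

/-- The row lengths of a Young diagram, as a weight. -/
noncomputable def weight (μ : YoungDiagram) : ℕ →₀ ℕ :=
  ∑ c ∈ μ.cells, Finsupp.single c.1 1

theorem weight_apply (μ : YoungDiagram) (i : ℕ) : μ.weight i = μ.rowLen i := by
  rw [weight, Finsupp.finsetSum_apply, rowLen_eq_card, row, Finset.card_filter]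
  exact Finset.sum_congr rfl fun c _ => Finsupp.single_apply

end YoungDiagram

/-! ### Contents of tableaux are dominated by shapes. -/

namespace SemistandardYoungTableau

variable {ν : YoungDiagram}

/-- The content of a semistandard Young tableau. -/
noncomputable def content (T : SemistandardYoungTableau ν) : ℕ →₀ ℕ :=
  ∑ c ∈ ν.cells, Finsupp.single (T c.1 c.2) 1

theorem content_apply (T : SemistandardYoungTableau ν) (k : ℕ) :
    T.content k = (ν.cells.filter fun c => T c.1 c.2 = k).card := by
  rw [content, Finsupp.finsetSum_apply, Finset.card_filter]
  exact Finset.sum_congr rfl fun c _ => Finsupp.single_apply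

theorem row_le (T : SemistandardYoungTableau ν) {i j : ℕ} (h : (i, j) ∈ ν) : i ≤ T i j := by
  induction i with
  | zero => exact Nat.zero_le _
  | succ i ih =>
    have h1 := ih (ν.up_left_mem (Nat.le_succ i) le_rfl h)
    have h2 := T.col_strict (Nat.lt_add_one i) h
    omega

/-- Entries in row `i` are at least `i`, so the letters below `k` all lie in the first `k` rows. -/
theorem sum_content_le (T : SemistandardYoungTableau ν) (k : ℕ) :
    ∑ i ∈ Finset.range k, T.content i ≤ ∑ i ∈ Finset.range k, ν.rowLen i := by
  have h : ∑ i ∈ Finset.range k, T.content i =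
      (ν.cells.filter fun c => T c.1 c.2 < k).card := by
    rw [Finset.card_eq_sum_card_fiberwise (f := fun c : ℕ × ℕ => T c.1 c.2) (t := Finset.range k)
      (fun c hc => by simpa using (Finset.mem_filter.1 hc).2)]
    refine Finset.sum_congr rfl fun i hi => ?_
    rw [content_apply, Finset.filter_filter]
    congr 1
    ext c
    have := Finset.mem_range.1 hi
    simp only [Finset.mem_filter, and_congr_right_iff]
    intro _
    constructor
    · exact fun h => ⟨by omega, h⟩
    · exact fun h => h.2
  rw [h, ← YoungDiagram.card_filter_row_lt]
  refine Finset.card_le_card fun c hc => ?_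
  obtain ⟨h1, h2⟩ := Finset.mem_filter.1 hc
  exact Finset.mem_filter.2 ⟨h1, (T.row_le h1).trans_lt h2⟩

theorem content_highestWeight (μ : YoungDiagram) : (highestWeight μ).content = μ.weight := by
  refine Finset.sum_congr rfl fun c hc => ?_
  rw [highestWeight_apply, if_pos ((YoungDiagram.mem_cells _).1 hc)]

theorem entry_mem_support (T : SemistandardYoungTableau ν) {c : ℕ × ℕ} (hc : c ∈ ν.cells) :
    T c.1 c.2 ∈ T.content.support := by
  rw [Finsupp.mem_support_iff, content_apply]
  have : c ∈ ν.cells.filter fun d => T d.1 d.2 = T c.1 c.2 := Finset.mem_filter.2 ⟨hc, rfl⟩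
  exact (Finset.card_pos.2 ⟨c, this⟩).ne'

end SemistandardYoungTableau

/-! ### Linear independence of the Schur functions. -/

namespace SkewShape

theorem SSYT.entry_injective {A : SkewShape} : Function.Injective (SSYT.entry (A := A)) := by
  rintro ⟨e, _, _⟩ ⟨e', _, _⟩ h
  obtain rfl : e = e' := h
  rfl

theorem mem_cells_straight {ν : YoungDiagram} {c : ℕ × ℕ} : c ∈ (straight ν).cells ↔ c ∈ ν := by
  simp [cells, straight]

/-- Tableaux of straight shape `ν / ∅` are the semistandard Young tableaux of shape `ν`. -/
def straightEquiv (ν : YoungDiagram) : (straight ν).SSYT ≃ SemistandardYoungTableau ν where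
  toFun T :=
    { entry := fun i j => if h : (i, j) ∈ (straight ν).cells then T.entry ⟨(i, j), h⟩ else 0
      row_weak' := fun {i j1 j2} hj h2 => by
        have h1 := ν.up_left_mem le_rfl hj.le h2
        rw [dif_pos (mem_cells_straight.2 h1), dif_pos (mem_cells_straight.2 h2)]
        exact T.row_weak _ _ rfl hj.le
      col_strict' := fun {i1 i2 j} hi h2 => by
        have h1 := ν.up_left_mem hi.le le_rfl h2
        rw [dif_pos (mem_cells_straight.2 h1), dif_pos (mem_cells_straight.2 h2)]
        exact T.col_strict _ _ rfl hi
      zeros' := fun {i j} h => dif_neg fun h' => h (mem_cells_straight.1 h') }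
  invFun T :=
    { entry := fun c => T c.1.1 c.1.2
      row_weak := by
        rintro ⟨⟨i, j⟩, hc⟩ ⟨⟨i', j'⟩, hd⟩ h1 h2
        obtain rfl : i = i' := h1
        exact T.row_weak_of_le h2 (mem_cells_straight.1 hd)
      col_strict := by
        rintro ⟨⟨i, j⟩, hc⟩ ⟨⟨i', j'⟩, hd⟩ h1 h2
        obtain rfl : j = j' := h1
        exact T.col_strict h2 (mem_cells_straight.1 hd) }
  left_inv T := by
    refine SSYT.entry_injective (funext fun c => ?_)
    exact dif_pos c.2
  right_inv T := by
    ext i j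
    by_cases h : (i, j) ∈ (straight ν).cells
    · exact dif_pos h
    · exact (dif_neg h).trans (T.zeros fun h' => h (mem_cells_straight.2 h')).symm

theorem content_straightEquiv_symm {ν : YoungDiagram} (T : SemistandardYoungTableau ν) :
    ((straightEquiv ν).symm T).content = T.content := by
  have : (straight ν).cells = ν.cells := by ext c; exact mem_cells_straight
  rw [SSYT.content, SemistandardYoungTableau.content, ← this]
  exact Finset.sum_coe_sort (straight ν).cells fun c => Finsupp.single (T c.1 c.2) 1

theorem content_straightEquiv {ν : YoungDiagram} (T : (straight ν).SSYT) :
    (straightEquiv ν T).content = T.content := by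
  rw [← content_straightEquiv_symm, Equiv.symm_apply_apply]

/-- The content-preserving correspondence behind `straightEquiv`. -/
def straightContentEquiv (ν : YoungDiagram) (w : ℕ →₀ ℕ) :
    {T : (straight ν).SSYT // T.content = w} ≃ {T : SemistandardYoungTableau ν // T.content = w} :=
  (straightEquiv ν).subtypeEquiv fun T => by rw [content_straightEquiv]

instance finite_content (ν : YoungDiagram) (w : ℕ →₀ ℕ) :
    Finite {T : SemistandardYoungTableau ν // T.content = w} :=
  have := finite_ssyt_content (straight ν) w
  Finite.of_equiv _ (straightContentEquiv ν w)

theorem coeff_schur (ν : YoungDiagram) (w : ℕ →₀ ℕ) :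
    MvPowerSeries.coeff w (schur ν) =
      (Nat.card {T : SemistandardYoungTableau ν // T.content = w} : ℚ) :=
  congrArg Nat.cast (Nat.card_congr (straightContentEquiv ν w))

theorem coeff_weight_schur_self_ne_zero (μ : YoungDiagram) :
    MvPowerSeries.coeff μ.weight (schur μ) ≠ 0 := by
  rw [coeff_schur, Nat.cast_ne_zero]
  have : Nonempty {T : SemistandardYoungTableau μ // T.content = μ.weight} :=
    ⟨⟨_, SemistandardYoungTableau.content_highestWeight μ⟩⟩
  exact Nat.card_pos.ne'

theorem sum_rowLen_le_of_coeff_ne_zero {μ ν : YoungDiagram}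
    (h : MvPowerSeries.coeff μ.weight (schur ν) ≠ 0) (k : ℕ) :
    ∑ i ∈ Finset.range k, μ.rowLen i ≤ ∑ i ∈ Finset.range k, ν.rowLen i := by
  rw [coeff_schur, Nat.cast_ne_zero] at h
  obtain ⟨T, hT⟩ := (Nat.card_ne_zero.1 h).1
  have := T.sum_content_le k
  simpa only [hT, YoungDiagram.weight_apply] using this

/-- The Schur functions are linearly independent. -/
theorem linearIndependent_schur : LinearIndependent ℚ schur := by
  rw [linearIndependent_iff]
  intro c hc
  by_contra hne
  let f : YoungDiagram → ℕ → ℕ := fun μ k => ∑ i ∈ Finset.range k, μ.rowLen i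
  have hf : Function.Injective f := fun μ ν h =>
    YoungDiagram.eq_of_sum_rowLen_eq fun k => congrFun h k
  -- Triangularity: $x^\mu$ occurs in $s_\nu$ only if $\nu$ dominates $\mu$. For a dominance-maximal
  -- $\mu$ in the support of `c`, only the term of $\mu$ itself contributes to the coefficient of
  -- $x^\mu$.
  obtain ⟨μ, hμ, hmax⟩ := (c.support).exists_maximalFor f (Finsupp.support_nonempty_iff.2 hne)
  have h0 := congrArg (MvPowerSeries.coeff μ.weight) hc
  rw [Finsupp.linearCombination_apply, Finsupp.sum, map_sum, map_zero,
    Finset.sum_eq_single_of_mem μ hμ] at h0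
  · rw [map_smul, smul_eq_mul, mul_eq_zero] at h0
    exact h0.elim (Finsupp.mem_support_iff.1 hμ) (coeff_weight_schur_self_ne_zero μ)
  · intro ν hν hνμ
    rw [map_smul, smul_eq_mul, mul_eq_zero]
    right
    by_contra h
    have hle : f μ ≤ f ν := sum_rowLen_le_of_coeff_ne_zero h
    exact hνμ (hf (le_antisymm (hmax hν hle) hle))

/-- The support can be read off from any expansion into Schur functions. -/
theorem mem_schurSupport_iff {A : SkewShape} {c : YoungDiagram →₀ ℚ}
    (h : skewSchur A = Finsupp.linearCombination ℚ schur c) (ν : YoungDiagram) :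
    ν ∈ A.schurSupport ↔ 0 < c ν := by
  constructor
  · rintro ⟨d, hd, hν⟩
    rw [← Finsupp.linearCombination_apply, h] at hd
    rwa [linearIndependent_schur hd]
  · exact fun hν => ⟨c, h, hν⟩

end SkewShape

/-! ### Diagrams with at most three rows, and horizontal strips. -/

namespace YoungDiagram

/-- The diagram with rows of lengths `a ≥ b ≥ c`. (The minima make this total.) -/
def threeRow (a b c : ℕ) : YoungDiagram where
  cells := {0} ×ˢ Finset.range a ∪ {1} ×ˢ Finset.range (min a b) ∪
    {2} ×ˢ Finset.range (min a (min b c))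
  isLowerSet := by
    rintro ⟨i2, j2⟩ ⟨i1, j1⟩ ⟨hi : i1 ≤ i2, hj : j1 ≤ j2⟩ h
    simp only [Finset.coe_union, Finset.coe_product, Set.mem_union, Set.mem_prod, Finset.mem_coe,
      Finset.mem_singleton, Finset.mem_range] at h ⊢
    omega

theorem mem_threeRow {a b c : ℕ} (hb : b ≤ a) (hc : c ≤ b) {i j : ℕ} :
    (i, j) ∈ threeRow a b c ↔ i = 0 ∧ j < a ∨ i = 1 ∧ j < b ∨ i = 2 ∧ j < c := by
  rw [← mem_cells]
  simp only [threeRow, Finset.mem_union, Finset.mem_product, Finset.mem_singleton,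
    Finset.mem_range]
  omega

theorem eq_of_forall_lt_iff {a b : ℕ} (h : ∀ j, j < a ↔ j < b) : a = b := by
  have h1 := h a
  have h2 := h b
  omega

theorem rowLen_threeRow {a b c : ℕ} (hb : b ≤ a) (hc : c ≤ b) (i : ℕ) :
    (threeRow a b c).rowLen i = if i = 0 then a else if i = 1 then b else if i = 2 then c else 0 := by
  refine eq_of_forall_lt_iff fun j => ?_
  rw [← mem_iff_lt_rowLen, mem_threeRow hb hc]
  split_ifs <;> omega

theorem threeRow_inj {a b c a' b' c' : ℕ} (hb : b ≤ a) (hc : c ≤ b) (hb' : b' ≤ a') (hc' : c' ≤ b') :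
    threeRow a b c = threeRow a' b' c' ↔ a = a' ∧ b = b' ∧ c = c' := by
  constructor
  · intro h
    have h0 := fun i => congrArg (fun μ => μ.rowLen i) h
    simp only [rowLen_threeRow hb hc, rowLen_threeRow hb' hc'] at h0
    exact ⟨by simpa using h0 0, by simpa using h0 1, by simpa using h0 2⟩
  · rintro ⟨rfl, rfl, rfl⟩
    rfl

theorem eq_threeRow_of_rowLen_eq_zero {ν : YoungDiagram} (h : ν.rowLen 3 = 0) :
    ν = threeRow (ν.rowLen 0) (ν.rowLen 1) (ν.rowLen 2) := by
  refine ext_rowLen fun i => ?_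
  rw [rowLen_threeRow (ν.rowLen_anti 0 1 (by omega)) (ν.rowLen_anti 1 2 (by omega))]
  split_ifs with h0 h1 h2
  · rw [h0]
  · rw [h1]
  · rw [h2]
  · have := ν.rowLen_anti 3 i (by omega)
    omega

theorem card_threeRow {a b c : ℕ} (hb : b ≤ a) (hc : c ≤ b) : (threeRow a b c).card = a + b + c := by
  have h : (threeRow a b c).cells.filter (·.1 < 3) = (threeRow a b c).cells := by
    refine Finset.filter_true_of_mem ?_
    rintro ⟨i, j⟩ hij
    rw [mem_cells, mem_threeRow hb hc] at hij
    show i < 3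
    omega
  have h' := card_filter_row_lt (threeRow a b c) 3
  rw [h] at h'
  simpa [Finset.sum_range_succ, rowLen_threeRow hb hc] using h'

/-- `ν / μ` is a horizontal strip. -/
def IsHorizontalStrip (μ ν : YoungDiagram) : Prop :=
  μ ≤ ν ∧ ∀ i j, (i + 1, j) ∈ ν → (i, j) ∈ μ

/-- A horizontal strip amounts to interlacing row lengths: $\nu_{i+1}\le\mu_i\le\nu_i$. -/
theorem isHorizontalStrip_threeRow {a b c : ℕ} (hb : b ≤ a) (hc : c ≤ b) (μ : YoungDiagram) :
    IsHorizontalStrip μ (threeRow a b c) ↔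
      ∃ x y z, (b ≤ x ∧ x ≤ a) ∧ (c ≤ y ∧ y ≤ b) ∧ z ≤ c ∧ threeRow x y z = μ := by
  constructor
  · rintro ⟨h1, h2⟩
    have hlt : ∀ i, μ.rowLen i ≤ (threeRow a b c).rowLen i := fun i => by
      by_contra! h
      exact lt_irrefl _ (mem_iff_lt_rowLen.1 (h1 (mem_iff_lt_rowLen.2 h)))
    have hgt : ∀ i, (threeRow a b c).rowLen (i + 1) ≤ μ.rowLen i := fun i => by
      by_contra! h
      exact lt_irrefl _ (mem_iff_lt_rowLen.1 (h2 _ _ (mem_iff_lt_rowLen.2 h)))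
    simp only [rowLen_threeRow hb hc] at hlt hgt
    refine ⟨μ.rowLen 0, μ.rowLen 1, μ.rowLen 2, ⟨hgt 0, hlt 0⟩, ⟨hgt 1, hlt 1⟩, hlt 2,
      (eq_threeRow_of_rowLen_eq_zero ?_).symm⟩
    have := hlt 3
    simp at this
    omega
  · rintro ⟨x, y, z, h1, h2, h3, rfl⟩
    constructor
    · rintro ⟨i, j⟩ h
      rw [mem_threeRow (by omega) (by omega)] at h ⊢
      omega
    · intro i j h
      rw [mem_threeRow (by omega) (by omega)] at h ⊢
      omega

end YoungDiagram

/-! ### Adding and removing the largest letter of a tableau. -/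

namespace SemistandardYoungTableau

variable {μ ν : YoungDiagram}

/-- The restriction of a tableau to a smaller diagram. -/
def restrict (T : SemistandardYoungTableau ν) (h : μ ≤ ν) : SemistandardYoungTableau μ where
  entry i j := if (i, j) ∈ μ then T i j else 0
  row_weak' {i j1 j2} hj h2 := by
    rw [if_pos h2, if_pos (μ.up_left_mem le_rfl hj.le h2)]
    exact T.row_weak hj (h h2)
  col_strict' {i1 i2 j} hi h2 := by
    rw [if_pos h2, if_pos (μ.up_left_mem hi.le le_rfl h2)]
    exact T.col_strict hi (h h2)
  zeros' h := if_neg h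

/-- Filling the horizontal strip `ν / μ` with a letter exceeding those of a tableau of shape `μ`. -/
def extend (T : SemistandardYoungTableau μ) (N : ℕ) (h : μ.IsHorizontalStrip ν)
    (hT : ∀ i j, (i, j) ∈ μ → T i j < N) : SemistandardYoungTableau ν where
  entry i j := if (i, j) ∈ μ then T i j else if (i, j) ∈ ν then N else 0
  row_weak' {i j1 j2} hj h2 := by
    have h1 := ν.up_left_mem le_rfl hj.le h2
    by_cases h2' : (i, j2) ∈ μ
    · rw [if_pos h2', if_pos (μ.up_left_mem le_rfl hj.le h2')]
      exact T.row_weak hj h2'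
    · rw [if_neg h2', if_pos h2]
      split_ifs with h3
      · exact (hT _ _ h3).le
      · exact le_rfl
  col_strict' {i1 i2 j} hi h2 := by
    -- The strip condition puts the box directly above `(i2, j)` in `μ`, hence every higher box of
    -- the column too.
    have h1 : (i1, j) ∈ μ := by
      obtain ⟨i, rfl⟩ : ∃ i, i2 = i + 1 := ⟨i2 - 1, by omega⟩
      exact μ.up_left_mem (by omega) le_rfl (h.2 _ _ h2)
    rw [if_pos h1]
    by_cases h2' : (i2, j) ∈ μ
    · rw [if_pos h2']
      exact T.col_strict hi h2'
    · rw [if_neg h2', if_pos h2]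
      exact hT _ _ h1
  zeros' {i j} hn := by
    rw [if_neg fun h' => hn (h.1 h'), if_neg hn]

/-- The diagram formed by the boxes with entries less than `N`. -/
def shapeBelow (T : SemistandardYoungTableau ν) (N : ℕ) : YoungDiagram where
  cells := ν.cells.filter fun c => T c.1 c.2 < N
  isLowerSet := by
    rintro ⟨i2, j2⟩ ⟨i1, j1⟩ ⟨hi : i1 ≤ i2, hj : j1 ≤ j2⟩ h
    simp only [Finset.coe_filter, YoungDiagram.mem_cells, Set.mem_ofPred_eq] at h ⊢
    have h1 := T.col_weak hi h.1
    have h2 := T.row_weak_of_le hj (ν.up_left_mem hi le_rfl h.1)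
    exact ⟨ν.up_left_mem hi hj h.1, by omega⟩

theorem mem_shapeBelow {T : SemistandardYoungTableau ν} {N i j : ℕ} :
    (i, j) ∈ T.shapeBelow N ↔ (i, j) ∈ ν ∧ T i j < N := by
  rw [← YoungDiagram.mem_cells, shapeBelow, Finset.mem_filter, YoungDiagram.mem_cells]

/-- All the letters of `T` are less than `N`. -/
def EntriesLT (T : SemistandardYoungTableau ν) (N : ℕ) : Prop := ∀ i j, (i, j) ∈ ν → T i j < N

/-- Columns are strict and entries are at most `N`, so any box with a box beneath it has an entry
less than `N`. -/
theorem isHorizontalStrip_shapeBelow {T : SemistandardYoungTableau ν} {N : ℕ}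
    (hT : T.EntriesLT (N + 1)) : (T.shapeBelow N).IsHorizontalStrip ν := by
  refine ⟨fun ⟨i, j⟩ h => (mem_shapeBelow.1 h).1, fun i j h => mem_shapeBelow.2
    ⟨ν.up_left_mem (Nat.le_succ i) le_rfl h, ?_⟩⟩
  have h1 := T.col_strict (Nat.lt_add_one i) h
  have h2 := hT _ _ h
  omega

theorem content_eq_of_shapeBelow {T : SemistandardYoungTableau ν} {N : ℕ}
    (hT : T.EntriesLT (N + 1)) (h : μ ≤ ν) (hμ : T.shapeBelow N = μ) :
    T.content = (T.restrict h).content + Finsupp.single N (ν.card - μ.card) := by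
  subst hμ
  have hsub := YoungDiagram.cells_subset_iff.2 h
  rw [content, ← Finset.sum_sdiff hsub, add_comm]
  congr 1
  · refine Finset.sum_congr rfl fun c hc => ?_
    exact congrArg (fun k => Finsupp.single k 1) (if_pos ((YoungDiagram.mem_cells c).1 hc)).symm
  · rw [← Finset.card_sdiff_of_subset hsub, Finset.sum_congr rfl (g := fun _ => Finsupp.single N 1)]
    · rw [Finset.sum_const, Finsupp.smul_single, smul_eq_mul, mul_one]
    · rintro ⟨i, j⟩ hc
      rw [Finset.mem_sdiff, YoungDiagram.mem_cells, YoungDiagram.mem_cells, mem_shapeBelow] at hc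
      have h1 := hT i j hc.1
      have h2 : ¬ T i j < N := fun h => hc.2 ⟨hc.1, h⟩
      rw [show T (i, j).1 (i, j).2 = N from by show T i j = N; omega]

theorem restrict_extend (T : SemistandardYoungTableau μ) {N : ℕ} (h : μ.IsHorizontalStrip ν)
    (hT : T.EntriesLT N) : (T.extend N h hT).restrict h.1 = T := by
  ext i j
  by_cases hm : (i, j) ∈ μ
  · exact (if_pos hm).trans (if_pos hm)
  · exact (if_neg hm).trans (T.zeros hm).symm

theorem entriesLT_extend (T : SemistandardYoungTableau μ) {N : ℕ} (h : μ.IsHorizontalStrip ν)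
    (hT : T.EntriesLT N) : (T.extend N h hT).EntriesLT (N + 1) := by
  intro i j hν
  show (if (i, j) ∈ μ then T i j else if (i, j) ∈ ν then N else 0) < N + 1
  split_ifs with h1
  · exact (hT i j h1).trans (Nat.lt_succ_self N)
  · exact Nat.lt_succ_self N

theorem shapeBelow_extend (T : SemistandardYoungTableau μ) {N : ℕ} (h : μ.IsHorizontalStrip ν)
    (hT : T.EntriesLT N) : (T.extend N h hT).shapeBelow N = μ := by
  ext ⟨i, j⟩
  rw [YoungDiagram.mem_cells, mem_shapeBelow, YoungDiagram.mem_cells]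
  show (_ ∧ (if (i, j) ∈ μ then T i j else if (i, j) ∈ ν then N else 0) < N) ↔ _
  by_cases hm : (i, j) ∈ μ
  · rw [if_pos hm]
    exact ⟨fun _ => hm, fun _ => ⟨h.1 hm, hT i j hm⟩⟩
  · rw [if_neg hm]
    refine ⟨fun h' => ?_, fun h' => absurd h' hm⟩
    rw [if_pos h'.1] at h'
    exact absurd h'.2 (lt_irrefl N)

theorem extend_restrict (T : SemistandardYoungTableau ν) {N : ℕ} (h : μ.IsHorizontalStrip ν)
    (hT : T.EntriesLT (N + 1)) (hμ : T.shapeBelow N = μ) (hr : (T.restrict h.1).EntriesLT N) :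
    (T.restrict h.1).extend N h hr = T := by
  subst hμ
  ext i j
  by_cases hm : (i, j) ∈ T.shapeBelow N
  · exact (if_pos hm).trans (if_pos hm)
  · refine (if_neg hm).trans ?_
    split_ifs with hν
    · have h1 := hT i j hν
      have h2 : ¬ T i j < N := fun h => hm (mem_shapeBelow.2 ⟨hν, h⟩)
      omega
    · exact (T.zeros hν).symm

theorem entriesLT_restrict (T : SemistandardYoungTableau ν) {N : ℕ} (h : μ ≤ ν)
    (hμ : T.shapeBelow N = μ) : (T.restrict h).EntriesLT N := by
  subst hμ
  intro i j hm
  show (if _ then _ else _) < N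
  rw [if_pos hm]
  exact (mem_shapeBelow.1 hm).2

/-- Removing the letter `N` from tableaux with letters at most `N`. -/
def branchEquiv (N : ℕ) (w : ℕ →₀ ℕ) (h : μ.IsHorizontalStrip ν) :
    {T : {T : SemistandardYoungTableau ν // T.EntriesLT (N + 1) ∧ T.content = w} //
      T.1.shapeBelow N = μ} ≃
    {T : SemistandardYoungTableau μ // T.EntriesLT N ∧
      T.content + Finsupp.single N (ν.card - μ.card) = w} where
  toFun T := ⟨T.1.1.restrict h.1, T.1.1.entriesLT_restrict h.1 T.2, by
    rw [← content_eq_of_shapeBelow T.1.2.1 h.1 T.2, T.1.2.2]⟩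
  invFun T := ⟨⟨T.1.extend N h T.2.1, T.1.entriesLT_extend h T.2.1, by
    rw [content_eq_of_shapeBelow (T.1.entriesLT_extend h T.2.1) h.1 (T.1.shapeBelow_extend h T.2.1),
      restrict_extend, T.2.2]⟩, T.1.shapeBelow_extend h T.2.1⟩
  left_inv T := Subtype.ext (Subtype.ext (extend_restrict _ h T.1.2.1 T.2 (T.1.1.entriesLT_restrict h.1 T.2)))
  right_inv T := Subtype.ext (restrict_extend _ h T.2.1)

end SemistandardYoungTableau

/-! ### Schur polynomials in finitely many variables and their branching rule. -/

theorem Nat.card_eq_sum_card_fiberwise {α ι : Type*} [Finite α] [DecidableEq ι] (f : α → ι)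
    (s : Finset ι) (h : ∀ x, f x ∈ s) : Nat.card α = ∑ i ∈ s, Nat.card {x // f x = i} := by
  have := Fintype.ofFinite α
  rw [Nat.card_eq_fintype_card, ← Finset.card_univ,
    Finset.card_eq_sum_card_fiberwise (f := f) (t := s) fun x _ => h x]
  refine Finset.sum_congr rfl fun i _ => ?_
  rw [Nat.card_eq_fintype_card, Fintype.card_subtype]

namespace SkewShape

open SemistandardYoungTableau YoungDiagram

/-- The Schur function of `ν` in the variables `x_0, …, x_{N-1}`. -/
noncomputable def truncSchur (N : ℕ) (ν : YoungDiagram) : MvPowerSeries ℕ ℚ := fun w =>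
  (Nat.card {T : SemistandardYoungTableau ν // T.EntriesLT N ∧ T.content = w} : ℚ)

instance finite_truncated (N : ℕ) (ν : YoungDiagram) (w : ℕ →₀ ℕ) :
    Finite {T : SemistandardYoungTableau ν // T.EntriesLT N ∧ T.content = w} :=
  Finite.of_injective (fun T => (⟨T.1, T.2.2⟩ : {T : SemistandardYoungTableau ν // T.content = w}))
    fun _ _ h => Subtype.ext (congrArg (fun T => T.1) h)

theorem coeff_truncSchur (N : ℕ) (ν : YoungDiagram) (w : ℕ →₀ ℕ) :
    MvPowerSeries.coeff w (truncSchur N ν) =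
      (Nat.card {T : SemistandardYoungTableau ν // T.EntriesLT N ∧ T.content = w} : ℚ) := rfl

theorem coeff_truncSchur_eq_coeff_schur {N : ℕ} (ν : YoungDiagram) {w : ℕ →₀ ℕ}
    (hw : w.support ⊆ Finset.range N) :
    MvPowerSeries.coeff w (truncSchur N ν) = MvPowerSeries.coeff w (schur ν) := by
  rw [coeff_truncSchur, coeff_schur]
  refine congrArg Nat.cast (Nat.card_congr (Equiv.subtypeEquivRight fun T => ?_))
  refine ⟨fun h => h.2, ?_⟩
  rintro rfl
  exact ⟨fun i j h => Finset.mem_range.1 (hw (T.entry_mem_support (c := (i, j)) h)), rfl⟩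

/-- Branching rule: tableaux are sorted by the shape `μ` of their letters below `N`; the strip left
over holds only `N` and contributes a power of $x_N$. -/
theorem truncSchur_succ (N : ℕ) (ν : YoungDiagram) (s : Finset YoungDiagram)
    (hs : ∀ μ, μ ∈ s ↔ μ.IsHorizontalStrip ν) :
    truncSchur (N + 1) ν = ∑ μ ∈ s,
      MvPowerSeries.monomial (Finsupp.single N (ν.card - μ.card)) 1 * truncSchur N μ := by
  classical
  ext w
  rw [map_sum, coeff_truncSchur, Nat.card_eq_sum_card_fiberwise (fun T => T.1.shapeBelow N) s
    fun T => (hs _).2 (isHorizontalStrip_shapeBelow T.2.1), Nat.cast_sum]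
  refine Finset.sum_congr rfl fun μ hμ => ?_
  rw [Nat.card_congr (branchEquiv N w ((hs μ).1 hμ)), MvPowerSeries.coeff_monomial_mul]
  split_ifs with hle
  · rw [one_mul, coeff_truncSchur]
    refine congrArg Nat.cast (Nat.card_congr (Equiv.subtypeEquivRight fun T => ?_))
    rw [eq_tsub_iff_add_eq_of_le hle]
  · rw [Nat.cast_eq_zero, Nat.card_eq_zero]
    exact Or.inl ⟨fun T => hle (T.2.2 ▸ le_add_self)⟩

theorem truncSchur_succ_threeRow (N : ℕ) {a b c : ℕ} (hb : b ≤ a) (hc : c ≤ b) :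
    truncSchur (N + 1) (threeRow a b c) =
      ∑ m ∈ Finset.Icc b a ×ˢ Finset.Icc c b ×ˢ Finset.range (c + 1),
        MvPowerSeries.monomial (Finsupp.single N (a + b + c - (m.1 + m.2.1 + m.2.2))) 1 *
          truncSchur N (threeRow m.1 m.2.1 m.2.2) := by
  classical
  rw [truncSchur_succ N _ ((Finset.Icc b a ×ˢ Finset.Icc c b ×ˢ Finset.range (c + 1)).image
    fun m => threeRow m.1 m.2.1 m.2.2), Finset.sum_image]
  · refine Finset.sum_congr rfl ?_
    rintro ⟨x, y, z⟩ h
    simp only [Finset.mem_product, Finset.mem_Icc, Finset.mem_range] at h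
    dsimp only
    rw [card_threeRow hb hc, card_threeRow (by omega) (by omega)]
  · rintro ⟨x, y, z⟩ h ⟨x', y', z'⟩ h' heq
    simp only [Finset.coe_product, Set.mem_prod, Finset.mem_coe, Finset.mem_Icc,
      Finset.mem_range] at h h'
    dsimp only at heq
    obtain ⟨rfl, rfl, rfl⟩ :=
      (threeRow_inj (by omega) (by omega) (by omega) (by omega)).1 heq
    rfl
  · intro μ
    rw [isHorizontalStrip_threeRow hb hc, Finset.mem_image]
    constructor
    · rintro ⟨⟨x, y, z⟩, h, h'⟩
      simp only [Finset.mem_product, Finset.mem_Icc, Finset.mem_range] at h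
      exact ⟨x, y, z, h.1, h.2.1, by omega, h'⟩
    · rintro ⟨x, y, z, h1, h2, h3, h⟩
      refine ⟨(x, y, z), ?_, h⟩
      simp only [Finset.mem_product, Finset.mem_Icc, Finset.mem_range]
      omega

theorem truncSchur_zero_bot : truncSchur 0 ⊥ = 1 := by
  classical
  ext w
  rw [coeff_truncSchur, MvPowerSeries.coeff_one]
  have h0 : ∀ T : SemistandardYoungTableau ⊥, T.EntriesLT 0 ∧ T.content = 0 := fun T =>
    ⟨fun i j h => absurd h (notMem_bot _), by rw [content, cells_bot, Finset.sum_empty]⟩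
  split_ifs with hw
  · subst hw
    rw [Nat.cast_eq_one, Nat.card_eq_one_iff_unique]
    refine ⟨⟨fun T T' => Subtype.ext ?_⟩, ⟨⟨_, h0 default⟩⟩⟩
    ext i j
    rw [T.1.zeros (notMem_bot _), T'.1.zeros (notMem_bot _)]
  · rw [Nat.cast_eq_zero, Nat.card_eq_zero]
    exact Or.inl ⟨fun T => hw (T.2.2.symm.trans (h0 T.1).2)⟩

theorem truncSchur_zero_of_mem {ν : YoungDiagram} {c : ℕ × ℕ} (h : c ∈ ν) : truncSchur 0 ν = 0 := by
  ext w
  rw [coeff_truncSchur, MvPowerSeries.coeff_zero, Nat.cast_eq_zero, Nat.card_eq_zero]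
  exact Or.inl ⟨fun T => Nat.not_lt_zero _ (T.2.1 c.1 c.2 h)⟩

theorem truncSchur_zero_threeRow {a b c : ℕ} (hb : b ≤ a) (hc : c ≤ b) :
    truncSchur 0 (threeRow a b c) = if a = 0 then 1 else 0 := by
  split_ifs with h
  · rw [← truncSchur_zero_bot]
    congr 1
    ext ⟨i, j⟩
    rw [mem_cells, mem_threeRow hb hc, cells_bot]
    simp
    omega
  · exact truncSchur_zero_of_mem (c := (0, 0)) ((mem_threeRow hb hc).2 (by omega))

end SkewShape

/-! ### Pieri's rule for partitions with at most two parts. -/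

namespace SkewShape

open SemistandardYoungTableau YoungDiagram

theorem truncSchur_succ_twoRow (N : ℕ) {p q : ℕ} (hq : q ≤ p) :
    truncSchur (N + 1) (threeRow p q 0) =
      ∑ m ∈ Finset.Icc q p ×ˢ Finset.range (q + 1),
        MvPowerSeries.monomial (Finsupp.single N (p + q - (m.1 + m.2))) 1 *
          truncSchur N (threeRow m.1 m.2 0) := by
  rw [truncSchur_succ_threeRow N hq (Nat.zero_le _), Finset.sum_product, Finset.sum_product]
  refine Finset.sum_congr rfl fun x _ => ?_
  rw [Finset.sum_product]
  refine Finset.sum_congr (Nat.range_succ_eq_Icc_zero q).symm fun y _ => ?_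
  simp

theorem truncSchur_succ_row (N a : ℕ) :
    truncSchur (N + 1) (threeRow a 0 0) =
      ∑ i ∈ Finset.range (a + 1),
        MvPowerSeries.monomial (Finsupp.single N (a - i)) 1 * truncSchur N (threeRow i 0 0) := by
  rw [truncSchur_succ_twoRow N (Nat.zero_le _), Finset.sum_product]
  refine Finset.sum_congr (Nat.range_succ_eq_Icc_zero a).symm fun x _ => ?_
  simp

/-- The pairs (second part, third part) of the partitions obtained from `(p, q)` by adding a
horizontal strip of size `a`. -/
def pieriIndex (a p q : ℕ) : Finset (ℕ × ℕ) :=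
  (Finset.Icc q p ×ˢ Finset.range (q + 1)).filter fun m => m.1 + m.2 ≤ q + a

theorem mem_pieriIndex {a p q u v : ℕ} :
    (u, v) ∈ pieriIndex a p q ↔ (q ≤ u ∧ u ≤ p) ∧ v ≤ q ∧ u + v ≤ q + a := by
  simp only [pieriIndex, Finset.mem_filter, Finset.mem_product, Finset.mem_Icc, Finset.mem_range]
  omega

/-- Induction on the number of variables. Branching on both sides, and the induction hypothesis on
the left, leave sums of the same terms $x_N^{p+q+a-|\kappa|}s_\kappa$. On the left `κ` is reached
from `(p, q)` by removing a strip and then adding one, on the right by adding a strip of size `a`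
and then removing one. It remains to match the index sets. -/
theorem truncSchur_pieri (N : ℕ) {a p q : ℕ} (hq : q ≤ p) :
    truncSchur N (threeRow a 0 0) * truncSchur N (threeRow p q 0) =
      ∑ m ∈ pieriIndex a p q, truncSchur N (threeRow (p + q + a - (m.1 + m.2)) m.1 m.2) := by
  induction N generalizing a p q with
  | zero =>
    rw [truncSchur_zero_threeRow (Nat.zero_le _) le_rfl,
      truncSchur_zero_threeRow hq (Nat.zero_le _)]
    by_cases h : a = 0 ∧ p = 0
    · obtain ⟨rfl, rfl⟩ := h
      obtain rfl : q = 0 := by omega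
      have : pieriIndex 0 0 0 = {(0, 0)} := rfl
      rw [this, Finset.sum_singleton]
      simp [truncSchur_zero_threeRow]
    · rw [Finset.sum_eq_zero]
      · split_ifs <;> first | omega | simp
      · rintro ⟨u, v⟩ hm
        rw [mem_pieriIndex] at hm
        dsimp only
        rw [truncSchur_zero_threeRow (by omega) (by omega), if_neg (by omega)]
  | succ N ih =>
    have hR : ∀ m ∈ pieriIndex a p q,
        truncSchur (N + 1) (threeRow (p + q + a - (m.1 + m.2)) m.1 m.2) =
        ∑ k ∈ Finset.Icc m.1 (p + q + a - (m.1 + m.2)) ×ˢ Finset.Icc m.2 m.1 ×ˢ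
            Finset.range (m.2 + 1),
          MvPowerSeries.monomial (Finsupp.single N (p + q + a - (k.1 + k.2.1 + k.2.2))) 1 *
          truncSchur N (threeRow k.1 k.2.1 k.2.2) := by
      rintro ⟨u, v⟩ hm
      rw [mem_pieriIndex] at hm
      dsimp only
      rw [truncSchur_succ_threeRow N (by omega) (by omega),
        show p + q + a - (u + v) + u + v = p + q + a by omega]
    have hL : ∀ m ∈ Finset.range (a + 1) ×ˢ Finset.Icc q p ×ˢ Finset.range (q + 1),
        (MvPowerSeries.monomial (Finsupp.single N (a - m.1)) 1 * truncSchur N (threeRow m.1 0 0)) *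
        (MvPowerSeries.monomial (Finsupp.single N (p + q - (m.2.1 + m.2.2))) 1 *
          truncSchur N (threeRow m.2.1 m.2.2 0)) =
        ∑ k ∈ pieriIndex m.1 m.2.1 m.2.2,
          MvPowerSeries.monomial (Finsupp.single N (p + q + a - (m.1 + m.2.1 + m.2.2))) 1 *
          truncSchur N (threeRow (m.2.1 + m.2.2 + m.1 - (k.1 + k.2)) k.1 k.2) := by
      rintro ⟨i, x, y⟩ hm
      simp only [Finset.mem_product, Finset.mem_Icc, Finset.mem_range] at hm
      dsimp only
      rw [mul_mul_mul_comm, ih (by omega), MvPowerSeries.monomial_mul_monomial, one_mul,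
        ← Finsupp.single_add, Finset.mul_sum]
      refine Finset.sum_congr rfl fun k _ => ?_
      rw [show a - i + (p + q - (x + y)) = p + q + a - (i + x + y) by omega]
    rw [truncSchur_succ_row, truncSchur_succ_twoRow N hq, Finset.sum_mul_sum,
      ← Finset.sum_product', Finset.sum_congr rfl hL, Finset.sum_congr rfl hR,
      Finset.sum_sigma', Finset.sum_sigma']
    -- This is the local rule of the RSK correspondence. With $\mu=(x,y)$ the lower partition and
    -- $\lambda$ the upper one, both $\mu_1$ and $\lambda_2$ range between $\max(q,\kappa_2)$ and
    -- $\min(p,\kappa_1)$, both $\mu_2$ and $\lambda_3$ between $\kappa_3$ and $\min(q,\kappa_2)$.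
    -- The bijection reflects each interval; $\lambda_1$ and the size `i` of the added strip follow
    -- from the total sizes.
    refine Finset.sum_bij'
      (fun t _ => ⟨(max q t.2.1 + min p (t.1.2.1 + t.1.2.2 + t.1.1 - (t.2.1 + t.2.2)) - t.1.2.1,
        t.2.2 + min q t.2.1 - t.1.2.2),
        (t.1.2.1 + t.1.2.2 + t.1.1 - (t.2.1 + t.2.2), t.2.1, t.2.2)⟩)
      (fun t _ => ⟨(t.2.1 + t.2.2.1 + t.2.2.2 - (max q t.2.2.1 + min p t.2.1 - t.1.1) -
        (t.2.2.2 + min q t.2.2.1 - t.1.2), max q t.2.2.1 + min p t.2.1 - t.1.1,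
        t.2.2.2 + min q t.2.2.1 - t.1.2), (t.2.2.1, t.2.2.2)⟩) ?_ ?_ ?_ ?_ ?_
    · rintro ⟨⟨i, x, y⟩, u, v⟩ h
      simp only [Finset.mem_sigma, Finset.mem_product, Finset.mem_Icc, Finset.mem_range,
        mem_pieriIndex] at h ⊢
      omega
    · rintro ⟨⟨u', v'⟩, k, u, v⟩ h
      simp only [Finset.mem_sigma, Finset.mem_product, Finset.mem_Icc, Finset.mem_range,
        mem_pieriIndex] at h ⊢
      omega
    · rintro ⟨⟨i, x, y⟩, u, v⟩ h
      simp only [Finset.mem_sigma, Finset.mem_product, Finset.mem_Icc, Finset.mem_range,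
        mem_pieriIndex] at h
      simp only [Sigma.mk.injEq, Prod.mk.injEq, heq_eq_eq, and_true]
      omega
    · rintro ⟨⟨u', v'⟩, k, u, v⟩ h
      simp only [Finset.mem_sigma, Finset.mem_product, Finset.mem_Icc, Finset.mem_range,
        mem_pieriIndex] at h
      simp only [Sigma.mk.injEq, Prod.mk.injEq, heq_eq_eq, and_true]
      omega
    · rintro ⟨⟨i, x, y⟩, u, v⟩ h
      simp only [Finset.mem_sigma, Finset.mem_product, Finset.mem_Icc, Finset.mem_range,
        mem_pieriIndex] at h
      dsimp only
      rw [show i + x + y = x + y + i - (u + v) + u + v by omega]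

/-- Pieri's rule for partitions with at most two parts. -/
theorem schur_pieri {a p q : ℕ} (hq : q ≤ p) :
    schur (threeRow a 0 0) * schur (threeRow p q 0) =
      ∑ m ∈ pieriIndex a p q, schur (threeRow (p + q + a - (m.1 + m.2)) m.1 m.2) := by
  classical
  ext w
  -- A single coefficient involves only finitely many variables, and each summand of the exponent
  -- `w` involves no others, so the truncated identity suffices.
  obtain ⟨N, hN⟩ := w.support.exists_nat_subset_range
  have h := congrArg (MvPowerSeries.coeff w) (truncSchur_pieri N (a := a) hq)
  rw [map_sum, Finset.sum_congr rfl fun m _ => coeff_truncSchur_eq_coeff_schur _ hN] at h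
  rw [map_sum, ← h, MvPowerSeries.coeff_mul, MvPowerSeries.coeff_mul]
  refine Finset.sum_congr rfl fun z hz => ?_
  rw [Finset.HasAntidiagonal.mem_antidiagonal] at hz
  subst hz
  rw [coeff_truncSchur_eq_coeff_schur _ ((Finsupp.support_mono le_self_add).trans hN),
    coeff_truncSchur_eq_coeff_schur _ ((Finsupp.support_mono le_add_self).trans hN)]

end SkewShape

/-! ### Generating series of weighted types: products and splittings. -/

/-- The generating series of a type whose members have weights. -/
noncomputable def weightSeries {X : Type*} (wt : X → ℕ →₀ ℕ) : MvPowerSeries ℕ ℚ := fun w =>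
  (Nat.card {x // wt x = w} : ℚ)

namespace weightSeries

variable {X Y : Type*} {f : X → ℕ →₀ ℕ} {g : Y → ℕ →₀ ℕ}

theorem coeff_eq (w : ℕ →₀ ℕ) :
    MvPowerSeries.coeff w (weightSeries f) = (Nat.card {x // f x = w} : ℚ) := rfl

theorem congr (e : X ≃ Y) (h : ∀ x, g (e x) = f x) : weightSeries f = weightSeries g :=
  funext fun w => congrArg Nat.cast (Nat.card_congr (e.subtypeEquiv fun x => by rw [h]))

/-- Sorting the pairs of a given total weight by the weights of the two members. -/
def pairEquiv (f : X → ℕ →₀ ℕ) (g : Y → ℕ →₀ ℕ) (w : ℕ →₀ ℕ) :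
    {p : X × Y // f p.1 + g p.2 = w} ≃
      Σ z : Finset.HasAntidiagonal.antidiagonal w, {x // f x = z.1.1} × {y // g y = z.1.2} where
  toFun p := ⟨⟨(f p.1.1, g p.1.2), Finset.HasAntidiagonal.mem_antidiagonal.2 p.2⟩,
    ⟨p.1.1, rfl⟩, ⟨p.1.2, rfl⟩⟩
  invFun z := ⟨(z.2.1.1, z.2.2.1), by
    rw [z.2.1.2, z.2.2.2]
    exact Finset.HasAntidiagonal.mem_antidiagonal.1 z.1.2⟩
  left_inv _ := rfl
  right_inv := by
    rintro ⟨⟨⟨u, v⟩, h⟩, ⟨x, hx⟩, ⟨y, hy⟩⟩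
    dsimp only at hx hy
    subst hx hy
    rfl

theorem finite_pair (hf : ∀ w, Finite {x // f x = w}) (hg : ∀ w, Finite {y // g y = w})
    (w : ℕ →₀ ℕ) : Finite {p : X × Y // f p.1 + g p.2 = w} :=
  Finite.of_equiv _ (pairEquiv f g w).symm

theorem mul (hf : ∀ w, Finite {x // f x = w}) (hg : ∀ w, Finite {y // g y = w}) :
    weightSeries f * weightSeries g = weightSeries fun p : X × Y => f p.1 + g p.2 := by
  classical
  ext w
  rw [MvPowerSeries.coeff_mul, coeff_eq, Nat.card_congr (pairEquiv f g w), Nat.card_sigma,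
    Nat.cast_sum, ← Finset.sum_coe_sort]
  refine Finset.sum_congr rfl fun z _ => ?_
  rw [Nat.card_prod, Nat.cast_mul]
  rfl

theorem finite_subtype (hf : ∀ w, Finite {x // f x = w}) (P : X → Prop) (w : ℕ →₀ ℕ) :
    Finite {x : {x // P x} // f x.1 = w} :=
  have := hf w
  Finite.of_injective (fun x => (⟨x.1.1, x.2⟩ : {x // f x = w}))
    fun _ _ h => Subtype.ext (Subtype.ext (congrArg (fun x => x.1) h))

theorem split (hf : ∀ w, Finite {x // f x = w}) (P : X → Prop) :
    weightSeries f = weightSeries (fun x : {x // P x} => f x.1) +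
      weightSeries (fun x : {x // ¬ P x} => f x.1) := by
  classical
  ext w
  have h1 := finite_subtype hf P w
  have h2 := finite_subtype hf (fun x => ¬ P x) w
  have e : {x // f x = w} ≃
      {x : {x // P x} // f x.1 = w} ⊕ {x : {x // ¬ P x} // f x.1 = w} :=
    (Equiv.sumCompl fun x : {x // f x = w} => P x.1).symm.trans
      (Equiv.sumCongr (Equiv.subtypeSubtypeEquivSubtypeInter _ _ |>.trans
        ((Equiv.subtypeEquivRight fun _ => and_comm).trans
          (Equiv.subtypeSubtypeEquivSubtypeInter _ _).symm))
        (Equiv.subtypeSubtypeEquivSubtypeInter _ (fun x => ¬ P x) |>.trans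
        ((Equiv.subtypeEquivRight fun _ => and_comm).trans
          (Equiv.subtypeSubtypeEquivSubtypeInter (fun x => ¬ P x) _).symm)))
  rw [map_add, coeff_eq, coeff_eq, coeff_eq, Nat.card_congr e, Nat.card_sum, Nat.cast_add]

end weightSeries

/-! ### Increasing words, and ribbons cut into rows. -/

/-- Weakly increasing words of length `n`. -/
def MonotoneWord (n : ℕ) : Type := {f : Fin n → ℕ // Monotone f}

namespace MonotoneWord

instance (n : ℕ) : CoeFun (MonotoneWord n) fun _ => Fin n → ℕ := ⟨Subtype.val⟩

/-- The content of a word. -/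
noncomputable def content {n : ℕ} (f : MonotoneWord n) : ℕ →₀ ℕ := ∑ i, Finsupp.single (f i) 1

/-- The letter at position `k`, and `0` if there is none. -/
def letter {n : ℕ} (f : MonotoneWord n) (k : ℕ) : ℕ := if h : k < n then f ⟨k, h⟩ else 0

theorem letter_of_lt {n : ℕ} (f : MonotoneWord n) {k : ℕ} (h : k < n) : f.letter k = f ⟨k, h⟩ :=
  dif_pos h

theorem letter_mono {n : ℕ} (f : MonotoneWord n) {k l : ℕ} (h : k ≤ l) (hl : l < n) :
    f.letter k ≤ f.letter l := by
  rw [f.letter_of_lt hl, f.letter_of_lt (h.trans_lt hl)]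
  exact f.2 h

theorem content_eq_sum_range {n : ℕ} (f : MonotoneWord n) :
    f.content = ∑ k ∈ Finset.range n, Finsupp.single (f.letter k) 1 := by
  rw [content, ← Fin.sum_univ_eq_sum_range fun k => Finsupp.single (f.letter k) 1]
  exact Finset.sum_congr rfl fun i _ => by rw [f.letter_of_lt i.2]

/-- Some letter of `f` is less than some letter of `g`. -/
def SomeLT {m n : ℕ} (f : MonotoneWord m) (g : MonotoneWord n) : Prop := ∃ i j, f i < g j

theorem not_someLT_iff {m n : ℕ} {f : MonotoneWord m} {g : MonotoneWord n} :
    ¬ SomeLT f g ↔ ∀ i j, g j ≤ f i := by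
  simp [SomeLT]

/-- Concatenation of words. -/
def append {m n : ℕ} (g : MonotoneWord n) (f : MonotoneWord m) (h : ¬ SomeLT f g) :
    MonotoneWord (n + m) :=
  ⟨Fin.append g f, by
    rw [not_someLT_iff] at h
    intro i j hij
    induction i using Fin.addCases with
    | left i =>
      induction j using Fin.addCases with
      | left j =>
        rw [Fin.append_left, Fin.append_left]
        exact g.2 (Fin.le_def.2 hij)
      | right j =>
        rw [Fin.append_left, Fin.append_right]
        exact h j i
    | right i =>
      induction j using Fin.addCases with
      | left j =>
        simp only [Fin.le_def, Fin.val_natAdd, Fin.val_castAdd] at hij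
        omega
      | right j =>
        rw [Fin.append_right, Fin.append_right]
        exact f.2 (Fin.le_def.2 (Nat.le_of_add_le_add_left hij))⟩

/-- The first `n` letters of a word. -/
def left {m n : ℕ} (f : MonotoneWord (n + m)) : MonotoneWord n :=
  ⟨fun i => f (Fin.castAdd m i), fun _ _ h => f.2 (Fin.le_def.2 h)⟩

/-- The last `m` letters of a word. -/
def right {m n : ℕ} (f : MonotoneWord (n + m)) : MonotoneWord m :=
  ⟨fun i => f (Fin.natAdd n i), fun _ _ h => f.2 (Fin.le_def.2 (Nat.add_le_add_left h n))⟩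

theorem not_someLT_right_left {m n : ℕ} (f : MonotoneWord (n + m)) : ¬ SomeLT f.right f.left := by
  rw [not_someLT_iff]
  intro i j
  refine f.2 ?_
  simp only [Fin.le_def, Fin.val_natAdd, Fin.val_castAdd]
  omega

theorem left_append {m n : ℕ} (g : MonotoneWord n) (f : MonotoneWord m) (h : ¬ SomeLT f g) :
    (g.append f h).left = g :=
  Subtype.ext (funext fun i => Fin.append_left _ _ i)

theorem right_append {m n : ℕ} (g : MonotoneWord n) (f : MonotoneWord m) (h : ¬ SomeLT f g) :
    (g.append f h).right = f :=
  Subtype.ext (funext fun i => Fin.append_right _ _ i)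

theorem append_left_right {m n : ℕ} (f : MonotoneWord (n + m)) :
    f.left.append f.right f.not_someLT_right_left = f :=
  Subtype.ext (funext fun i => by
    induction i using Fin.addCases with
    | left i => exact Fin.append_left _ _ i
    | right i => exact Fin.append_right _ _ i)

theorem content_append {m n : ℕ} (g : MonotoneWord n) (f : MonotoneWord m) (h : ¬ SomeLT f g) :
    (g.append f h).content = g.content + f.content := by
  rw [content, Fin.sum_univ_add]
  congr 1
  · exact Finset.sum_congr rfl fun i _ =>
      congrArg (fun k => Finsupp.single k 1) (Fin.append_left _ _ i)
  · exact Finset.sum_congr rfl fun i _ =>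
      congrArg (fun k => Finsupp.single k 1) (Fin.append_right _ _ i)

/-- Only the largest letter of the second word matters, and since `0 < m` the concatenation has the
same one as `f`. Thus gluing a third row onto the second does not disturb the junction with the
first. -/
theorem someLT_append_iff {l m n : ℕ} (e : MonotoneWord l) (g : MonotoneWord n)
    (f : MonotoneWord m) (h : ¬ SomeLT f g) (hm : 0 < m) :
    SomeLT e (g.append f h) ↔ SomeLT e f := by
  constructor
  · rintro ⟨i, j, hij⟩
    induction j using Fin.addCases with
    | left j =>
      refine ⟨i, ⟨0, hm⟩, hij.trans_le ?_⟩
      exact (Fin.append_left _ _ j).trans_le (not_someLT_iff.1 h _ _)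
    | right j => exact ⟨i, j, hij.trans_eq (Fin.append_right _ _ j)⟩
  · rintro ⟨i, j, hij⟩
    exact ⟨i, Fin.natAdd n j, hij.trans_eq (Fin.append_right _ _ j).symm⟩

/-- This identifies `SomeLT` with column strictness in a ribbon: the first box of a row sits above
the last box of the next. -/
theorem someLT_iff_letter {m n : ℕ} (hm : 0 < m) (hn : 0 < n) {f : MonotoneWord m}
    {g : MonotoneWord n} : SomeLT f g ↔ f.letter 0 < g.letter (n - 1) := by
  rw [f.letter_of_lt hm, g.letter_of_lt (show n - 1 < n by omega)]
  constructor
  · rintro ⟨i, j, h⟩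
    refine (f.2 ?_).trans_lt (h.trans_le (g.2 ?_))
    · exact Fin.mk_le_of_le_val (Nat.zero_le _)
    · have := j.2
      rw [Fin.le_def]
      show j.1 ≤ n - 1
      omega
  · exact fun h => ⟨_, _, h⟩

open YoungDiagram SkewShape

/-- A weakly increasing word as a tableau with one row. -/
def toTableau {n : ℕ} (f : MonotoneWord n) : SemistandardYoungTableau (threeRow n 0 0) where
  entry i j := if i = 0 then f.letter j else 0
  row_weak' {i j1 j2} hj h := by
    rw [mem_threeRow (Nat.zero_le _) le_rfl] at h
    rw [if_pos (by omega), if_pos (by omega)]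
    exact f.letter_mono hj.le (by omega)
  col_strict' {i1 i2 j} hi h := by
    rw [mem_threeRow (Nat.zero_le _) le_rfl] at h
    omega
  zeros' {i j} h := by
    rw [mem_threeRow (Nat.zero_le _) le_rfl] at h
    split_ifs with h0
    · exact dif_neg (by omega)
    · rfl

theorem toTableau_zero_apply {n : ℕ} (f : MonotoneWord n) (j : ℕ) :
    f.toTableau 0 j = f.letter j :=
  show (if 0 = 0 then f.letter j else 0) = f.letter j from if_pos rfl

/-- Weakly increasing words are tableaux with one row. -/
def tableauEquiv (n : ℕ) : MonotoneWord n ≃ SemistandardYoungTableau (threeRow n 0 0) where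
  toFun := toTableau
  invFun T := ⟨fun k => T 0 k, fun k l h => T.row_weak_of_le h
    ((mem_threeRow (Nat.zero_le _) le_rfl).2 (by omega))⟩
  left_inv f := Subtype.ext (funext fun k => (f.toTableau_zero_apply k).trans (f.letter_of_lt k.2))
  right_inv T := by
    ext i j
    by_cases h : i = 0 ∧ j < n
    · obtain ⟨rfl, h⟩ := h
      exact (toTableau_zero_apply _ j).trans (letter_of_lt _ h)
    · have h' : (i, j) ∉ threeRow n 0 0 := by
        rw [mem_threeRow (Nat.zero_le _) le_rfl]
        omega
      rw [T.zeros h', SemistandardYoungTableau.zeros _ h']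

theorem content_tableauEquiv {n : ℕ} (f : MonotoneWord n) :
    (tableauEquiv n f).content = f.content := by
  have h : (threeRow n 0 0).cells = {0} ×ˢ Finset.range n := by
    ext ⟨i, j⟩
    rw [mem_cells, mem_threeRow (Nat.zero_le _) le_rfl]
    simp only [Finset.mem_product, Finset.mem_singleton, Finset.mem_range]
    omega
  rw [SemistandardYoungTableau.content, h, Finset.sum_product, Finset.sum_singleton,
    content_eq_sum_range]
  exact Finset.sum_congr rfl fun j _ =>
    congrArg (fun k => Finsupp.single k 1) (f.toTableau_zero_apply j)

theorem finite_content (n : ℕ) (w : ℕ →₀ ℕ) : Finite {f : MonotoneWord n // f.content = w} :=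
  Finite.of_equiv _ ((tableauEquiv n).subtypeEquiv (p := fun f => f.content = w)
    (q := fun T => T.content = w) fun f => by rw [content_tableauEquiv]).symm

theorem weightSeries_content (n : ℕ) :
    weightSeries (content (n := n)) = schur (threeRow n 0 0) := by
  rw [weightSeries.congr (tableauEquiv n) content_tableauEquiv]
  ext w
  rw [coeff_schur]
  rfl

/-- Pairs of words with `SomeLT` are the fillings of a connected ribbon with two rows. -/
def RibbonPair (a b : ℕ) : Type := {p : MonotoneWord a × MonotoneWord b // SomeLT p.1 p.2}

/-- The content of the two words together. -/
noncomputable def RibbonPair.content {a b : ℕ} (p : RibbonPair a b) : ℕ →₀ ℕ :=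
  p.1.1.content + p.1.2.content

theorem RibbonPair.finite_content (a b : ℕ) (w : ℕ →₀ ℕ) :
    Finite {p : RibbonPair a b // p.content = w} :=
  weightSeries.finite_subtype
    (weightSeries.finite_pair (MonotoneWord.finite_content a) (MonotoneWord.finite_content b)) _ w

/-- Words of length `b + a` are cut into two words. -/
def cutEquiv (a b : ℕ) :
    {p : MonotoneWord a × MonotoneWord b // ¬ SomeLT p.1 p.2} ≃ MonotoneWord (b + a) where
  toFun p := p.1.2.append p.1.1 p.2
  invFun f := ⟨(f.right, f.left), f.not_someLT_right_left⟩
  left_inv p := Subtype.ext (Prod.ext (right_append _ _ p.2) (left_append _ _ p.2))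
  right_inv f := append_left_right f

/-- A pair of words either fills a two-row ribbon or, if no letter of the first is below a letter of
the second, concatenates in reverse order to one increasing word. -/
theorem schur_row_mul_schur_row (a b : ℕ) :
    schur (threeRow a 0 0) * schur (threeRow b 0 0) =
      weightSeries (RibbonPair.content (a := a) (b := b)) + schur (threeRow (b + a) 0 0) := by
  rw [← weightSeries_content, ← weightSeries_content, ← weightSeries_content,
    weightSeries.mul (finite_content a) (finite_content b),
    weightSeries.split (weightSeries.finite_pair (finite_content a) (finite_content b))
      fun p => SomeLT p.1 p.2]
  congr 1
  refine weightSeries.congr (cutEquiv a b) fun p => ?_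
  exact (content_append _ _ p.2).trans (add_comm _ _)

/-- Pairs of a ribbon with two rows and a word: those which cannot be completed to a ribbon with
three rows. -/
def cutRibbonEquiv (a b c : ℕ) (hb : 0 < b) :
    {q : RibbonPair a b × MonotoneWord c // ¬ SomeLT q.1.1.2 q.2} ≃ RibbonPair a (c + b) where
  toFun q := ⟨(q.1.1.1.1, q.1.2.append q.1.1.1.2 q.2), (someLT_append_iff _ _ _ q.2 hb).2 q.1.1.2⟩
  invFun p := ⟨(⟨(p.1.1, p.1.2.right), (someLT_append_iff _ _ _ p.1.2.not_someLT_right_left hb).1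
    (by rw [append_left_right]; exact p.2)⟩, p.1.2.left), p.1.2.not_someLT_right_left⟩
  left_inv q := Subtype.ext (Prod.ext (Subtype.ext (Prod.ext rfl (right_append _ _ q.2)))
    (left_append _ _ q.2))
  right_inv p := Subtype.ext (Prod.ext rfl (append_left_right _))

/-- Triples of words which are the fillings of a connected ribbon with three rows. -/
def RibbonTriple (a b c : ℕ) : Type :=
  {q : RibbonPair a b × MonotoneWord c // SomeLT q.1.1.2 q.2}

/-- The content of the three words together. -/
noncomputable def RibbonTriple.content {a b c : ℕ} (q : RibbonTriple a b c) : ℕ →₀ ℕ :=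
  q.1.1.content + q.1.2.content

/-- The same dichotomy at the junction of the second and third rows. -/
theorem weightSeries_ribbonPair_mul (a b c : ℕ) (hb : 0 < b) :
    weightSeries (RibbonPair.content (a := a) (b := b)) * schur (threeRow c 0 0) =
      weightSeries (RibbonTriple.content (a := a) (b := b) (c := c)) +
        weightSeries (RibbonPair.content (a := a) (b := c + b)) := by
  rw [← weightSeries_content,
    weightSeries.mul (RibbonPair.finite_content a b) (finite_content c),
    weightSeries.split (weightSeries.finite_pair (RibbonPair.finite_content a b) (finite_content c))
      fun q => SomeLT q.1.1.2 q.2]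
  congr 1
  refine weightSeries.congr (cutRibbonEquiv a b c hb) fun q => ?_
  show q.1.1.1.1.content + (q.1.2.append q.1.1.1.2 q.2).content =
    q.1.1.1.1.content + q.1.1.1.2.content + q.1.2.content
  rw [content_append, add_assoc, add_comm q.1.2.content]

end MonotoneWord

/-! ### Tableaux of ribbon shape as triples of words. -/

namespace SkewShape

open YoungDiagram MonotoneWord

section Ribbon

variable {a b c : ℕ}

theorem mem_ribbon_cells (ha : 2 ≤ a) (hb : 2 ≤ b) (hc : 2 ≤ c) {i j : ℕ} :
    (i, j) ∈ (ribbon [a, b, c]).cells ↔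
      i = 0 ∧ b + c - 2 ≤ j ∧ j < a + b + c - 2 ∨ i = 1 ∧ c - 1 ≤ j ∧ j < b + c - 1 ∨
        i = 2 ∧ j < c := by
  rw [cells, Finset.mem_sdiff, mem_cells, mem_cells, ribbon, mem_ofRowLens, mem_ofRowLens]
  have h3 : [a, b, c].length = 3 := rfl
  simp only [List.length_map, List.length_range, h3, List.getElem_map, List.getElem_range]
  rcases i with _ | _ | _ | i <;> simp <;> omega

theorem ribbon_cells (ha : 2 ≤ a) (hb : 2 ≤ b) (hc : 2 ≤ c) :
    (ribbon [a, b, c]).cells = {0} ×ˢ Finset.Ico (b + c - 2) (a + b + c - 2) ∪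
      ({1} ×ˢ Finset.Ico (c - 1) (b + c - 1) ∪ {2} ×ˢ Finset.Ico 0 c) := by
  ext ⟨i, j⟩
  rw [mem_ribbon_cells ha hb hc]
  simp only [Finset.mem_union, Finset.mem_product, Finset.mem_singleton, Finset.mem_Ico]
  omega

theorem sum_ribbon_cells {M : Type*} [AddCommMonoid M] (ha : 2 ≤ a) (hb : 2 ≤ b) (hc : 2 ≤ c)
    (F : ℕ × ℕ → M) :
    ∑ x ∈ (ribbon [a, b, c]).cells, F x =
      ∑ k ∈ Finset.range a, F (0, b + c - 2 + k) + ∑ k ∈ Finset.range b, F (1, c - 1 + k) +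
        ∑ k ∈ Finset.range c, F (2, k) := by
  rw [ribbon_cells ha hb hc, Finset.sum_union, Finset.sum_union, Finset.sum_product,
    Finset.sum_product, Finset.sum_product, Finset.sum_singleton, Finset.sum_singleton,
    Finset.sum_singleton, Finset.sum_Ico_eq_sum_range, Finset.sum_Ico_eq_sum_range,
    Nat.Ico_zero_eq_range, show a + b + c - 2 - (b + c - 2) = a by omega,
    show b + c - 1 - (c - 1) = b by omega, add_assoc (∑ k ∈ Finset.range a, F (0, b + c - 2 + k))]
  · rw [Finset.disjoint_left]
    rintro ⟨i, j⟩ h h'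
    simp only [Finset.mem_product, Finset.mem_singleton] at h h'
    omega
  · rw [Finset.disjoint_left]
    rintro ⟨i, j⟩ h h'
    simp only [Finset.mem_union, Finset.mem_product, Finset.mem_singleton] at h h'
    omega

/-- The filling of the ribbon with three given words as rows. -/
def fillRibbon (f : MonotoneWord a) (g : MonotoneWord b) (h : MonotoneWord c) (x : ℕ × ℕ) : ℕ :=
  if x.1 = 0 then f.letter (x.2 - (b + c - 2)) else
    if x.1 = 1 then g.letter (x.2 - (c - 1)) else h.letter x.2

theorem fillRibbon_zero (f : MonotoneWord a) (g : MonotoneWord b) (h : MonotoneWord c) (j : ℕ) :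
    fillRibbon f g h (0, j) = f.letter (j - (b + c - 2)) := if_pos rfl

theorem fillRibbon_one (f : MonotoneWord a) (g : MonotoneWord b) (h : MonotoneWord c) (j : ℕ) :
    fillRibbon f g h (1, j) = g.letter (j - (c - 1)) := rfl

theorem fillRibbon_two (f : MonotoneWord a) (g : MonotoneWord b) (h : MonotoneWord c) (j : ℕ) :
    fillRibbon f g h (2, j) = h.letter j := rfl

/-- The tableau of ribbon shape with three given words as rows. -/
def ribbonOfWords (ha : 2 ≤ a) (hb : 2 ≤ b) (hc : 2 ≤ c) (q : RibbonTriple a b c) :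
    (ribbon [a, b, c]).SSYT where
  entry x := fillRibbon q.1.1.1.1 q.1.1.1.2 q.1.2 x.1
  row_weak := by
    rintro ⟨⟨i, j⟩, hx⟩ ⟨⟨i', j'⟩, hy⟩ h1 h2
    obtain rfl : i = i' := h1
    have h2 : j ≤ j' := h2
    rw [mem_ribbon_cells ha hb hc] at hx hy
    obtain hx | hx | hx := hx
    · obtain rfl := hx.1
      dsimp only
      rw [fillRibbon_zero, fillRibbon_zero]
      exact letter_mono _ (by omega) (by omega)
    · obtain rfl := hx.1
      dsimp only
      rw [fillRibbon_one, fillRibbon_one]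
      exact letter_mono _ (by omega) (by omega)
    · obtain rfl := hx.1
      dsimp only
      rw [fillRibbon_two, fillRibbon_two]
      exact letter_mono _ (by omega) (by omega)
  col_strict := by
    have h1 := (someLT_iff_letter (by omega) (by omega)).1 q.1.1.2
    have h2 := (someLT_iff_letter (by omega) (by omega)).1 q.2
    rintro ⟨⟨i, j⟩, hx⟩ ⟨⟨i', j'⟩, hy⟩ hj hi
    obtain rfl : j = j' := hj
    have hi : i < i' := hi
    rw [mem_ribbon_cells ha hb hc] at hx hy
    -- Two boxes in one column occur only in the two columns shared by consecutive rows.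
    obtain ⟨rfl, rfl, rfl⟩ | ⟨rfl, rfl, rfl⟩ :
        (i = 0 ∧ i' = 1 ∧ j = b + c - 2) ∨ (i = 1 ∧ i' = 2 ∧ j = c - 1) := by omega
    · dsimp only
      rw [fillRibbon_zero, fillRibbon_one, show b + c - 2 - (b + c - 2) = 0 by omega,
        show b + c - 2 - (c - 1) = b - 1 by omega]
      exact h1
    · dsimp only
      rw [fillRibbon_one, fillRibbon_two, show c - 1 - (c - 1) = 0 by omega]
      exact h2

/-- The rows of a tableau of ribbon shape. -/
def wordsOfRibbon (ha : 2 ≤ a) (hb : 2 ≤ b) (hc : 2 ≤ c) (T : (ribbon [a, b, c]).SSYT) :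
    RibbonTriple a b c :=
  ⟨(⟨(⟨fun k => T.entry ⟨(0, b + c - 2 + k), (mem_ribbon_cells ha hb hc).2 (by omega)⟩,
        fun k l h => T.row_weak _ _ rfl (Nat.add_le_add_left h _)⟩,
      ⟨fun k => T.entry ⟨(1, c - 1 + k), (mem_ribbon_cells ha hb hc).2 (by omega)⟩,
        fun k l h => T.row_weak _ _ rfl (Nat.add_le_add_left h _)⟩),
      ⟨0, by omega⟩, ⟨b - 1, by omega⟩,
      T.col_strict _ _ (show b + c - 2 + 0 = c - 1 + (b - 1) by omega) Nat.zero_lt_one⟩,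
    ⟨fun k => T.entry ⟨(2, k), (mem_ribbon_cells ha hb hc).2 (by omega)⟩,
        fun k l h => T.row_weak _ _ rfl h⟩),
    ⟨0, by omega⟩, ⟨c - 1, by omega⟩,
    T.col_strict _ _ (show c - 1 + 0 = c - 1 by omega) Nat.one_lt_two⟩

/-- The tableaux of ribbon shape are given by their rows. -/
def ribbonEquiv (ha : 2 ≤ a) (hb : 2 ≤ b) (hc : 2 ≤ c) :
    (ribbon [a, b, c]).SSYT ≃ RibbonTriple a b c where
  toFun := wordsOfRibbon ha hb hc
  invFun := ribbonOfWords ha hb hc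
  left_inv T := by
    let q := wordsOfRibbon ha hb hc T
    refine SSYT.entry_injective (funext ?_)
    rintro ⟨⟨i, j⟩, hx⟩
    have hx' := (mem_ribbon_cells ha hb hc).1 hx
    obtain hx' | hx' | hx' := hx'
    · obtain rfl := hx'.1
      refine (fillRibbon_zero q.1.1.1.1 q.1.1.1.2 q.1.2 j).trans ((letter_of_lt _ (by omega)).trans ?_)
      exact congrArg T.entry (Subtype.ext (Prod.ext rfl (by dsimp only; omega)))
    · obtain rfl := hx'.1
      refine (fillRibbon_one q.1.1.1.1 q.1.1.1.2 q.1.2 j).trans ((letter_of_lt _ (by omega)).trans ?_)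
      exact congrArg T.entry (Subtype.ext (Prod.ext rfl (by dsimp only; omega)))
    · obtain rfl := hx'.1
      exact (fillRibbon_two q.1.1.1.1 q.1.1.1.2 q.1.2 j).trans (letter_of_lt _ (by omega))
  right_inv q := by
    refine Subtype.ext (Prod.ext (Subtype.ext (Prod.ext (Subtype.ext (funext fun k => ?_))
      (Subtype.ext (funext fun k => ?_)))) (Subtype.ext (funext fun k => ?_)))
    · refine (fillRibbon_zero q.1.1.1.1 q.1.1.1.2 q.1.2 _).trans ?_
      rw [Nat.add_sub_cancel_left, letter_of_lt _ k.2]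
    · refine (fillRibbon_one q.1.1.1.1 q.1.1.1.2 q.1.2 _).trans ?_
      rw [Nat.add_sub_cancel_left, letter_of_lt _ k.2]
    · exact (fillRibbon_two q.1.1.1.1 q.1.1.1.2 q.1.2 _).trans (letter_of_lt _ k.2)

theorem content_ribbonOfWords (ha : 2 ≤ a) (hb : 2 ≤ b) (hc : 2 ≤ c) (q : RibbonTriple a b c) :
    (ribbonOfWords ha hb hc q).content = q.content := by
  have h := Finset.sum_coe_sort (ribbon [a, b, c]).cells fun x =>
    Finsupp.single (fillRibbon q.1.1.1.1 q.1.1.1.2 q.1.2 x) 1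
  refine h.trans ?_
  rw [sum_ribbon_cells ha hb hc]
  show _ = q.1.1.1.1.content + q.1.1.1.2.content + q.1.2.content
  simp only [fillRibbon_zero, fillRibbon_one, fillRibbon_two, Nat.add_sub_cancel_left,
    content_eq_sum_range]

theorem skewSchur_ribbon_eq_weightSeries (ha : 2 ≤ a) (hb : 2 ≤ b) (hc : 2 ≤ c) :
    skewSchur (ribbon [a, b, c]) = weightSeries (RibbonTriple.content (a := a) (b := b) (c := c)) :=
  (weightSeries.congr (ribbonEquiv ha hb hc).symm (content_ribbonOfWords ha hb hc)).symm

/-- The ribbon Schur function in terms of complete homogeneous symmetric functions. -/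
theorem skewSchur_ribbon (ha : 2 ≤ a) (hb : 2 ≤ b) (hc : 2 ≤ c) :
    skewSchur (ribbon [a, b, c]) =
      schur (threeRow c 0 0) *
        (schur (threeRow b 0 0) * schur (threeRow a 0 0) - schur (threeRow (a + b) 0 0)) -
      (schur (threeRow (b + c) 0 0) * schur (threeRow a 0 0) - schur (threeRow (a + b + c) 0 0)) := by
  have h1 := schur_row_mul_schur_row a b
  have h2 := schur_row_mul_schur_row a (c + b)
  have h3 := weightSeries_ribbonPair_mul a b c (by omega)
  rw [skewSchur_ribbon_eq_weightSeries ha hb hc]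
  rw [show c + b + a = a + b + c by ring] at h2
  rw [add_comm c b] at h2 h3
  rw [add_comm b a] at h1
  -- Eliminates the two-row ribbons `(a, b)` and `(a, b + c)` from the three-row recursion `h3`.
  linear_combination -h3 - h1 * schur (threeRow c 0 0) + h2

end Ribbon

end SkewShape

/-! ### Partitions from multisets of parts, and dominance for three rows. -/

/-- In a weakly decreasing list the entries exceeding `k` form an initial segment. -/
theorem List.exists_lt_getElem_iff_lt_countP {l : List ℕ} (hl : l.Pairwise (· ≥ ·)) (k i : ℕ) :
    (∃ h : i < l.length, k < l[i]) ↔ i < l.countP (k < ·) := by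
  induction l generalizing i with
  | nil => simp
  | cons x l ih =>
    rw [List.pairwise_cons] at hl
    by_cases hx : k < x
    · rw [List.countP_cons_of_pos (by simpa using hx)]
      cases i with
      | zero => simp [hx]
      | succ i => simp [← ih hl.2 i]
    · have h0 : l.countP (k < ·) = 0 := by
        rw [List.countP_eq_zero]
        intro y hy
        have := hl.1 y hy
        simp only [decide_eq_true_eq]
        omega
      rw [List.countP_cons_of_neg (by simpa using hx), h0]
      simp only [Nat.not_lt_zero, iff_false, not_exists, not_lt]
      intro hi
      cases i with
      | zero => simpa using hx
      | succ i =>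
        have := hl.1 _ (List.getElem_mem (Nat.lt_of_succ_lt_succ hi))
        rw [List.getElem_cons_succ]
        omega

namespace YoungDiagram

/-- Column lengths do not depend on the order of the parts, so diagrams can be compared through them
without computing a sorted list. -/
theorem colLen_partitionOfParts (s : Multiset ℕ) (k : ℕ) :
    (partitionOfParts s).colLen k = s.countP (k < ·) := by
  refine eq_of_forall_lt_iff fun i => ?_
  rw [← mem_iff_lt_colLen, partitionOfParts, mem_ofRowLens]
  refine (List.exists_lt_getElem_iff_lt_countP (s.pairwise_sort (· ≥ ·)) k i).trans ?_
  conv_rhs => rw [← s.sort_eq (· ≥ ·)]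
  rw [Multiset.coe_countP]

theorem ext_colLen {μ ν : YoungDiagram} (h : ∀ j, μ.colLen j = ν.colLen j) : μ = ν := by
  ext ⟨i, j⟩
  rw [mem_cells, mem_cells, mem_iff_lt_colLen, mem_iff_lt_colLen, h]

theorem colLen_threeRow {a b c : ℕ} (hb : b ≤ a) (hc : c ≤ b) (k : ℕ) :
    (threeRow a b c).colLen k =
      (if k < a then 1 else 0) + (if k < b then 1 else 0) + if k < c then 1 else 0 := by
  refine eq_of_forall_lt_iff fun i => ?_
  rw [← mem_iff_lt_colLen, mem_threeRow hb hc]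
  split_ifs <;> omega

theorem partitionOfParts_three (a b c : ℕ) :
    partitionOfParts {a, b, c} = threeRow (max a (max b c))
      (a + b + c - max a (max b c) - min a (min b c)) (min a (min b c)) := by
  refine ext_colLen fun k => ?_
  rw [colLen_partitionOfParts, colLen_threeRow (by omega) (by omega)]
  simp only [Multiset.insert_eq_cons, Multiset.countP_cons, ← Multiset.cons_zero,
    Multiset.countP_zero]
  split_ifs <;> omega

theorem partitionOfParts_two {a b : ℕ} (h : b ≤ a) : partitionOfParts {a, b} = threeRow a b 0 := by
  refine ext_colLen fun k => ?_
  rw [colLen_partitionOfParts, colLen_threeRow h (Nat.zero_le _)]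
  simp only [Multiset.insert_eq_cons, Multiset.countP_cons, ← Multiset.cons_zero,
    Multiset.countP_zero]
  split_ifs <;> omega

theorem sum_rowLen_threeRow {a b c : ℕ} (hb : b ≤ a) (hc : c ≤ b) (k : ℕ) :
    ∑ i ∈ Finset.range k, (threeRow a b c).rowLen i =
      if k = 0 then 0 else if k = 1 then a else if k = 2 then a + b else a + b + c := by
  induction k with
  | zero => simp
  | succ k ih =>
    rw [Finset.sum_range_succ, ih, rowLen_threeRow hb hc]
    rcases k with _ | _ | _ | k <;> simp

theorem dominanceLE_threeRow_iff {a b c x y z : ℕ} (hb : b ≤ a) (hc : c ≤ b) (hy : y ≤ x)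
    (hz : z ≤ y) : DominanceLE (threeRow a b c) (threeRow x y z) ↔
      a + b + c = x + y + z ∧ a ≤ x ∧ a + b ≤ x + y := by
  rw [DominanceLE, card_threeRow hb hc, card_threeRow hy hz]
  simp only [sum_rowLen_threeRow hb hc, sum_rowLen_threeRow hy hz]
  constructor
  · rintro ⟨h, h'⟩
    exact ⟨h, by simpa using h' 1, by simpa using h' 2⟩
  · rintro ⟨h, h1, h2⟩
    refine ⟨h, fun k => ?_⟩
    split_ifs <;> omega

/-- The first three rows of `ν` already account for its whole size, so the fourth is empty. -/
theorem exists_eq_threeRow_of_dominanceLE {a b c : ℕ} (hb : b ≤ a) (hc : c ≤ b) {ν : YoungDiagram}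
    (h : DominanceLE (threeRow a b c) ν) :
    ∃ x y z, y ≤ x ∧ z ≤ y ∧ ν = threeRow x y z := by
  refine ⟨_, _, _, ν.rowLen_anti 0 1 (by omega), ν.rowLen_anti 1 2 (by omega),
    eq_threeRow_of_rowLen_eq_zero ?_⟩
  have h1 := h.1
  have h2 := h.2 3
  have h3 := Finset.card_filter_le ν.cells (·.1 < 4)
  rw [card_filter_row_lt, Finset.sum_range_succ] at h3
  rw [card_threeRow hb hc] at h1
  rw [sum_rowLen_threeRow hb hc] at h2
  simp only [OfNat.ofNat_ne_zero, OfNat.ofNat_ne_one, if_false, Nat.reduceEqDiff] at h2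
  have : ν.card = ν.cells.card := rfl
  omega

end YoungDiagram

/-! ### The Schur interval of a three-row ribbon. -/

namespace SkewShape

open YoungDiagram

theorem rowLen_transpose_colPartition (A : SkewShape) (k : ℕ) :
    A.colPartition.transpose.rowLen k =
      ((A.cells.image Prod.snd).filter fun j => k < (A.cells.filter (·.2 = j)).card).card := by
  rw [rowLen_transpose, colPartition, colLen_partitionOfParts, Multiset.countP_map]
  rfl

section Ribbon

variable {a b c : ℕ}

theorem sum_range_ite_add_eq (m n j : ℕ) :
    (∑ k ∈ Finset.range n, if m + k = j then 1 else 0) = if m ≤ j ∧ j < m + n then 1 else 0 := by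
  induction n with
  | zero => rw [Finset.range_zero, Finset.sum_empty, if_neg (by omega)]
  | succ n ih =>
    rw [Finset.sum_range_succ, ih]
    split_ifs <;> omega

/-- The columns `c - 1` and `b + c - 2` are those shared by consecutive rows. They are distinct
because `2 ≤ b`, so no column has three boxes. -/
theorem card_column_ribbon (ha : 2 ≤ a) (hb : 2 ≤ b) (hc : 2 ≤ c) (j : ℕ) :
    ((ribbon [a, b, c]).cells.filter (·.2 = j)).card =
      if j = c - 1 ∨ j = b + c - 2 then 2 else if j < a + b + c - 2 then 1 else 0 := by
  have h := sum_range_ite_add_eq 0 c j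
  simp only [zero_add] at h
  rw [Finset.card_filter, sum_ribbon_cells ha hb hc, sum_range_ite_add_eq, sum_range_ite_add_eq, h]
  split_ifs <;> omega

theorem colPartition_transpose_ribbon (ha : 2 ≤ a) (hb : 2 ≤ b) (hc : 2 ≤ c) :
    (ribbon [a, b, c]).colPartition.transpose = threeRow (a + b + c - 2) 2 0 := by
  have himg : (ribbon [a, b, c]).cells.image Prod.snd = Finset.range (a + b + c - 2) := by
    ext j
    rw [Finset.mem_image, Finset.mem_range]
    constructor
    · rintro ⟨⟨i, j'⟩, h, rfl⟩
      rw [mem_ribbon_cells ha hb hc] at h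
      dsimp only
      omega
    · intro h
      by_cases h1 : j < c
      · exact ⟨(2, j), (mem_ribbon_cells ha hb hc).2 (by omega), rfl⟩
      · by_cases h2 : j < b + c - 1
        · exact ⟨(1, j), (mem_ribbon_cells ha hb hc).2 (by omega), rfl⟩
        · exact ⟨(0, j), (mem_ribbon_cells ha hb hc).2 (by omega), rfl⟩
  refine ext_rowLen fun k => ?_
  rw [rowLen_transpose_colPartition, rowLen_threeRow (by omega) (by omega), himg]
  simp only [card_column_ribbon ha hb hc]
  split_ifs with h0 h1 h2
  · subst h0
    rw [Finset.filter_true_of_mem, Finset.card_range]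
    intro j hj
    rw [Finset.mem_range] at hj
    split_ifs <;> omega
  · subst h1
    rw [show (Finset.range (a + b + c - 2)).filter
      (fun j => 1 < if j = c - 1 ∨ j = b + c - 2 then 2 else if j < a + b + c - 2 then 1 else 0) =
        {c - 1, b + c - 2} from ?_]
    · exact Finset.card_pair (by omega)
    · ext j
      rw [Finset.mem_filter, Finset.mem_range, Finset.mem_insert, Finset.mem_singleton]
      split_ifs <;> omega
  all_goals
    rw [Finset.card_eq_zero, Finset.filter_eq_empty_iff]
    intro j _
    split_ifs <;> omega

theorem rowPartition_ribbon (ha : 2 ≤ a) (hb : 2 ≤ b) (hc : 2 ≤ c) :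
    (ribbon [a, b, c]).rowPartition = partitionOfParts {a, b, c} := by
  have himg : (ribbon [a, b, c]).cells.image Prod.fst = {0, 1, 2} := by
    ext i
    rw [Finset.mem_image]
    simp only [Finset.mem_insert, Finset.mem_singleton]
    constructor
    · rintro ⟨⟨i', j⟩, h, rfl⟩
      rw [mem_ribbon_cells ha hb hc] at h
      dsimp only
      omega
    · rintro (rfl | rfl | rfl)
      · exact ⟨(0, b + c - 2), (mem_ribbon_cells ha hb hc).2 (by omega), rfl⟩
      · exact ⟨(1, c - 1), (mem_ribbon_cells ha hb hc).2 (by omega), rfl⟩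
      · exact ⟨(2, 0), (mem_ribbon_cells ha hb hc).2 (by omega), rfl⟩
  have hcard : ∀ i, ((ribbon [a, b, c]).cells.filter (·.1 = i)).card =
      if i = 0 then a else if i = 1 then b else if i = 2 then c else 0 := by
    intro i
    rw [Finset.card_filter, sum_ribbon_cells ha hb hc]
    rcases i with _ | _ | _ | i <;> simp
  rw [rowPartition, himg]
  simp only [hcard]
  rfl

/-- The Schur interval of a connected ribbon with three rows. -/
theorem mem_schurInterval_ribbon_iff (ha : 2 ≤ a) (hb : 2 ≤ b) (hc : 2 ≤ c) (ν : YoungDiagram) :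
    ν ∈ (ribbon [a, b, c]).schurInterval ↔
      ∃ x y z, y ≤ x ∧ z ≤ y ∧ ν = threeRow x y z ∧ x + y + z = a + b + c ∧
        max a (max b c) ≤ x ∧ z ≤ min a (min b c) ∧ x + 2 ≤ a + b + c := by
  rw [schurInterval, Set.mem_ofPred_eq, rowPartition_ribbon ha hb hc, partitionOfParts_three,
    colPartition_transpose_ribbon ha hb hc]
  constructor
  · rintro ⟨h1, h2⟩
    obtain ⟨x, y, z, hy, hz, rfl⟩ := exists_eq_threeRow_of_dominanceLE (by omega) (by omega) h1
    rw [dominanceLE_threeRow_iff (by omega) (by omega) hy hz] at h1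
    rw [dominanceLE_threeRow_iff hy hz (by omega) (by omega)] at h2
    exact ⟨x, y, z, hy, hz, rfl, by omega, by omega, by omega, by omega⟩
  · rintro ⟨x, y, z, hy, hz, rfl, h1, h2, h3, h4⟩
    rw [dominanceLE_threeRow_iff (by omega) (by omega) hy hz,
      dominanceLE_threeRow_iff hy hz (by omega) (by omega)]
    omega

end Ribbon

end SkewShape

/-! ### Schur coefficients and support of a three-row ribbon. -/

namespace SkewShape

open YoungDiagram

/-- The subtracted term is the one with second part 0 in Pieri's rule. -/
theorem schur_row_mul_schur_row_sub (a b : ℕ) :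
    schur (threeRow b 0 0) * schur (threeRow a 0 0) - schur (threeRow (a + b) 0 0) =
      ∑ y ∈ Finset.Icc 1 (min a b), schur (threeRow (a + b - y) y 0) := by
  have h : pieriIndex b a 0 =
      insert (0, 0) ((Finset.Icc 1 (min a b)).image fun y => (y, 0)) := by
    ext ⟨u, v⟩
    rw [mem_pieriIndex]
    simp only [Finset.mem_insert, Finset.mem_image, Finset.mem_Icc, Prod.mk.injEq]
    constructor
    · intro h
      by_cases hu : u = 0
      · exact Or.inl (by omega)
      · exact Or.inr ⟨u, by omega⟩
    · rintro (h | ⟨y, h⟩) <;> omega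
  rw [schur_pieri (Nat.zero_le _), h, Finset.sum_insert, Finset.sum_image]
  · simp
  · intro y _ y' _ h
    exact congrArg Prod.fst h
  · simp

section Ribbon

variable {a b c : ℕ}

/-- The coefficients of the ribbon Schur function in the basis of Schur functions. -/
noncomputable def ribbonCoeff (a b c : ℕ) : YoungDiagram →₀ ℚ :=
  ∑ k ∈ Finset.Icc 1 (min a b), ∑ m ∈ pieriIndex c (a + b - k) k,
    Finsupp.single (threeRow (a + b + c - (m.1 + m.2)) m.1 m.2) 1 -
  ∑ y ∈ Finset.Icc 1 (min a (b + c)), Finsupp.single (threeRow (a + b + c - y) y 0) 1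

theorem skewSchur_ribbon_eq_linearCombination (ha : 2 ≤ a) (hb : 2 ≤ b) (hc : 2 ≤ c) :
    skewSchur (ribbon [a, b, c]) = Finsupp.linearCombination ℚ schur (ribbonCoeff a b c) := by
  rw [skewSchur_ribbon ha hb hc, schur_row_mul_schur_row_sub, add_assoc a b c,
    schur_row_mul_schur_row_sub, ribbonCoeff, map_sub, map_sum, map_sum, Finset.mul_sum]
  congr 1
  · refine Finset.sum_congr rfl fun k hk => ?_
    rw [Finset.mem_Icc] at hk
    rw [schur_pieri (by omega), map_sum]
    refine Finset.sum_congr rfl fun m _ => ?_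
    rw [Finsupp.linearCombination_single, one_smul, show a + b - k + k + c = a + b + c by omega]
  · refine Finset.sum_congr rfl fun y _ => ?_
    rw [Finsupp.linearCombination_single, one_smul, add_assoc]

theorem sum_pieriIndex_single_apply {k x y z : ℕ} (hy : y ≤ x) (hz : z ≤ y)
    (hn : x + y + z = a + b + c) :
    (∑ m ∈ pieriIndex c (a + b - k) k,
      Finsupp.single (threeRow (a + b + c - (m.1 + m.2)) m.1 m.2) (1 : ℚ)) (threeRow x y z) =
      if (y, z) ∈ pieriIndex c (a + b - k) k then 1 else 0 := by
  classical
  rw [Finsupp.finsetSum_apply, ← Finset.sum_ite_eq' _ (y, z) fun _ => (1 : ℚ)]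
  refine Finset.sum_congr rfl ?_
  rintro ⟨u, v⟩ hm
  rw [mem_pieriIndex] at hm
  rw [Finsupp.single_apply]
  refine if_congr ?_ rfl rfl
  rw [threeRow_inj (by dsimp only; omega) (by dsimp only; omega) hy hz, Prod.mk.injEq]
  dsimp only
  omega

/-- For given `(x, y, z)` the Pieri conditions on $(a+b-k,k)$ confine `k` to an interval, and each
such `k` contributes 1. Truncated subtraction gives 0 when the interval is empty. -/
theorem ribbonCoeff_threeRow {x y z : ℕ} (hy : y ≤ x) (hz : z ≤ y) (hn : x + y + z = a + b + c) :
    ribbonCoeff a b c (threeRow x y z) =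
      ((min (min a b) (min y (a + b - y)) + 1 - max 1 (max z (y + z - c)) : ℕ) : ℚ) -
        if z = 0 ∧ 1 ≤ y ∧ y ≤ min a (b + c) then 1 else 0 := by
  classical
  rw [ribbonCoeff, Finsupp.sub_apply]
  congr 1
  · rw [Finsupp.finsetSum_apply, Finset.sum_congr rfl fun _ _ =>
      sum_pieriIndex_single_apply hy hz hn, Finset.sum_boole,
      ← Nat.card_Icc]
    congr 2
    ext k
    rw [Finset.mem_filter, mem_pieriIndex, Finset.mem_Icc, Finset.mem_Icc]
    omega
  · rw [Finsupp.finsetSum_apply]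
    have h : ∀ t ∈ Finset.Icc 1 (min a (b + c)),
        (Finsupp.single (threeRow (a + b + c - t) t 0) (1 : ℚ)) (threeRow x y z) =
          if y = t then (if z = 0 then 1 else 0) else 0 := by
      intro t ht
      rw [Finset.mem_Icc] at ht
      rw [Finsupp.single_apply, ← ite_and]
      by_cases h : t ≤ a + b + c - t
      · refine if_congr ?_ rfl rfl
        rw [threeRow_inj h (Nat.zero_le _) hy hz]
        omega
      · omega
    rw [Finset.sum_congr rfl h, Finset.sum_ite_eq, ← ite_and]
    refine if_congr ?_ rfl rfl
    rw [Finset.mem_Icc]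
    omega

/-- The support of a connected ribbon with three rows. -/
theorem mem_schurSupport_ribbon_iff (ha : 2 ≤ a) (hb : 2 ≤ b) (hc : 2 ≤ c) (ν : YoungDiagram) :
    ν ∈ (ribbon [a, b, c]).schurSupport ↔
      ∃ x y z, y ≤ x ∧ z ≤ y ∧ ν = threeRow x y z ∧ x + y + z = a + b + c ∧
        (if z = 0 ∧ 1 ≤ y ∧ y ≤ min a (b + c) then 1 else 0) <
          min (min a b) (min y (a + b - y)) + 1 - max 1 (max z (y + z - c)) := by
  classical
  rw [mem_schurSupport_iff (skewSchur_ribbon_eq_linearCombination ha hb hc)]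
  have hpos : ∀ x y z, y ≤ x → z ≤ y → x + y + z = a + b + c →
      (0 < ribbonCoeff a b c (threeRow x y z) ↔
        (if z = 0 ∧ 1 ≤ y ∧ y ≤ min a (b + c) then 1 else 0) <
          min (min a b) (min y (a + b - y)) + 1 - max 1 (max z (y + z - c))) := by
    intro x y z hy hz hn
    rw [ribbonCoeff_threeRow hy hz hn, sub_pos]
    split_ifs <;> norm_cast
  constructor
  · intro h
    obtain ⟨x, y, z, hy, hz, rfl, hn⟩ :
        ∃ x y z, y ≤ x ∧ z ≤ y ∧ ν = threeRow x y z ∧ x + y + z = a + b + c := by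
      -- The positive sum contains only three-row partitions of `a + b + c`; at any other diagram
      -- the coefficient is at most 0.
      by_contra! hne
      refine h.not_ge ?_
      rw [ribbonCoeff, Finsupp.sub_apply, Finsupp.finsetSum_apply, Finsupp.finsetSum_apply,
        Finset.sum_eq_zero, zero_sub, neg_nonpos]
      · refine Finset.sum_nonneg fun y _ => ?_
        rw [Finsupp.single_apply]
        split_ifs <;> norm_num
      · intro k hk
        rw [Finset.mem_Icc] at hk
        rw [Finsupp.finsetSum_apply]
        refine Finset.sum_eq_zero ?_
        rintro ⟨u, v⟩ hm
        rw [mem_pieriIndex] at hm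
        refine Finsupp.single_eq_of_ne fun h => ?_
        exact hne _ u v (by omega) (by omega) h (by omega)
    exact ⟨x, y, z, hy, hz, rfl, hn, (hpos x y z hy hz hn).1 h⟩
  · rintro ⟨x, y, z, hy, hz, rfl, hn, h⟩
    exact (hpos x y z hy hz hn).2 h

/-- A nonempty range of `k` gives the bounds: $z\le a+b-y$ means $c\le x$, while $y+z-c\le b$,
$y+z-c\le a$ and $y+z-c\le y$ give $a\le x$, $b\le x$ and $z\le c$. At $(n-1,1)$ the only value
$k=1$ is cancelled, whence $x\le n-2$. -/
theorem schurSupport_ribbon_subset (ha : 2 ≤ a) (hb : 2 ≤ b) (hc : 2 ≤ c) :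
    (ribbon [a, b, c]).schurSupport ⊆ (ribbon [a, b, c]).schurInterval := by
  intro ν h
  rw [mem_schurSupport_ribbon_iff ha hb hc] at h
  rw [mem_schurInterval_ribbon_iff ha hb hc]
  obtain ⟨x, y, z, hy, hz, rfl, hn, h⟩ := h
  refine ⟨x, y, z, hy, hz, rfl, hn, ?_⟩
  split_ifs at h <;> omega

/-- At $(a,b+c)$ the only value is $k=b$, cancelled by the subtracted term; at $(c,a+b)$ the upper
bound $a+b-y$ is 0, so there is no `k` at all. -/
theorem threeRow_notMem_schurSupport_ribbon (ha : 2 ≤ a) (hb : 2 ≤ b) (hc : 2 ≤ c) {x y : ℕ}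
    (hy : y ≤ x)
    (h : x = a ∧ y = b + c ∨ x = c ∧ y = a + b) :
    threeRow x y 0 ∉ (ribbon [a, b, c]).schurSupport := by
  rw [mem_schurSupport_ribbon_iff ha hb hc]
  rintro ⟨x', y', z', hy', hz', heq, hn, h'⟩
  obtain ⟨rfl, rfl, rfl⟩ := (threeRow_inj hy (Nat.zero_le _) hy' hz').1 heq
  split_ifs at h' <;> omega

theorem threeRow_mem_schurInterval_ribbon (ha : 2 ≤ a) (hb : 2 ≤ b) (hc : 2 ≤ c) {x y : ℕ}
    (hy : y ≤ x)
    (h : x = a ∧ y = b + c ∨ x = c ∧ y = a + b) :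
    threeRow x y 0 ∈ (ribbon [a, b, c]).schurInterval := by
  rw [mem_schurInterval_ribbon_iff ha hb hc]
  exact ⟨x, y, 0, hy, Nat.zero_le _, rfl, by omega, by omega, by omega, by omega⟩

/-- The connected ribbons with three rows of length at least two which have full support. -/
theorem hasFullSupport_ribbon_iff (ha : 2 ≤ a) (hb : 2 ≤ b) (hc : 2 ≤ c) :
    (ribbon [a, b, c]).HasFullSupport ↔ ¬ (b + c ≤ a ∨ a + b ≤ c) := by
  constructor
  · rintro h (h' | h')
    · have h1 := threeRow_mem_schurInterval_ribbon ha hb hc h' (Or.inl ⟨rfl, rfl⟩)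
      rw [← h] at h1
      exact threeRow_notMem_schurSupport_ribbon ha hb hc h' (Or.inl ⟨rfl, rfl⟩) h1
    · have h1 := threeRow_mem_schurInterval_ribbon ha hb hc h' (Or.inr ⟨rfl, rfl⟩)
      rw [← h] at h1
      exact threeRow_notMem_schurSupport_ribbon ha hb hc h' (Or.inr ⟨rfl, rfl⟩) h1
  · intro h
    refine (schurSupport_ribbon_subset ha hb hc).antisymm fun ν hν => ?_
    rw [mem_schurInterval_ribbon_iff ha hb hc] at hν
    rw [mem_schurSupport_ribbon_iff ha hb hc]
    obtain ⟨x, y, z, hy, hz, rfl, hn, h'⟩ := hν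
    refine ⟨x, y, z, hy, hz, rfl, hn, ?_⟩
    -- Where 1 is subtracted, two values of `k` are needed; this fails only if $y=b+c$ or $x=y=a$,
    -- both forcing $b+c\le a$. Otherwise one value is needed; it is missing only if $z=0$ and
    -- $y=a+b$, so that $x=c\ge a+b$.
    split_ifs <;> omega

end Ribbon

end SkewShape

/-- First part: classification of full support for the connected ribbons of length three with
parts at least two. (If `b₂ + b₃ ≤ b₁` then `b₁` is the largest part, and similarly for `b₃`.)
Second part: the middle part being at least the sum of the other two, the ribbon has full support
but its weakly decreasing rearrangement has not. Third part: a non-monotone instance exists. -/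
theorem mainTheorem8 :
    (∀ b₁ b₂ b₃ : ℕ, 2 ≤ b₁ → 2 ≤ b₂ → 2 ≤ b₃ →
      ((SkewShape.ribbon [b₁, b₂, b₃]).HasFullSupport ↔ ¬ (b₂ + b₃ ≤ b₁ ∨ b₁ + b₂ ≤ b₃)) ∧
      (b₂ + b₃ ≤ b₁ →
        partitionOfParts {b₁, b₂ + b₃} ∈ (SkewShape.ribbon [b₁, b₂, b₃]).schurInterval ∧
        partitionOfParts {b₁, b₂ + b₃} ∉ (SkewShape.ribbon [b₁, b₂, b₃]).schurSupport) ∧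
      (b₁ + b₂ ≤ b₃ →
        partitionOfParts {b₃, b₁ + b₂} ∈ (SkewShape.ribbon [b₁, b₂, b₃]).schurInterval ∧
        partitionOfParts {b₃, b₁ + b₂} ∉ (SkewShape.ribbon [b₁, b₂, b₃]).schurSupport)) ∧
    (∀ b₁ b₂ b₃ : ℕ, 2 ≤ b₁ → 2 ≤ b₂ → 2 ≤ b₃ → b₁ + b₃ ≤ b₂ →
      (SkewShape.ribbon [b₁, b₂, b₃]).HasFullSupport ∧
      ¬ (SkewShape.ribbon [b₂, max b₁ b₃, min b₁ b₃]).HasFullSupport) ∧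
    (∃ b₁ b₂ b₃ : ℕ, 2 ≤ b₁ ∧ 2 ≤ b₂ ∧ 2 ≤ b₃ ∧
      ¬ [b₁, b₂, b₃].SortedGE ∧ ¬ [b₁, b₂, b₃].SortedLE ∧
      (SkewShape.ribbon [b₁, b₂, b₃]).HasFullSupport ∧
      ¬ (SkewShape.ribbon (Multiset.sort {b₁, b₂, b₃} (· ≥ ·))).HasFullSupport) := by
  open SkewShape YoungDiagram in
  refine ⟨fun a b c ha hb hc => ⟨hasFullSupport_ribbon_iff ha hb hc, fun h => ?_, fun h => ?_⟩,
    fun a b c ha hb hc h => ⟨(hasFullSupport_ribbon_iff ha hb hc).2 (by omega), fun h' => ?_⟩,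
    -- The smallest composition with parts at least 2 whose middle part is at least the sum of the
    -- others.
    2, 4, 2, le_rfl, by norm_num, le_rfl, ?_, ?_,
    (hasFullSupport_ribbon_iff le_rfl (by norm_num) le_rfl).2 (by norm_num), ?_⟩
  · rw [partitionOfParts_two h]
    exact ⟨threeRow_mem_schurInterval_ribbon ha hb hc h (Or.inl ⟨rfl, rfl⟩),
      threeRow_notMem_schurSupport_ribbon ha hb hc h (Or.inl ⟨rfl, rfl⟩)⟩
  · rw [partitionOfParts_two h]
    exact ⟨threeRow_mem_schurInterval_ribbon ha hb hc h (Or.inr ⟨rfl, rfl⟩),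
      threeRow_notMem_schurSupport_ribbon ha hb hc h (Or.inr ⟨rfl, rfl⟩)⟩
  · exact (hasFullSupport_ribbon_iff hb (by omega) (by omega)).1 h' (by omega)
  · exact fun h => absurd h.pairwise (by decide)
  · exact fun h => absurd h.pairwise (by decide)
  · have hs : Multiset.sort ({2, 4, 2} : Multiset ℕ) (· ≥ ·) = [4, 2, 2] := by
      rw [show ({2, 4, 2} : Multiset ℕ) = ↑[4, 2, 2] by decide, Multiset.coe_sort]
      exact List.mergeSort_of_pairwise (by decide)
    rw [hs, hasFullSupport_ribbon_iff (by norm_num) le_rfl le_rfl]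
    norm_num
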